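/- Let ${\mathbf k}$ be a differential field and let $\mathfrak M$ be a (multiplicative, totally) ordered abelian group with distinguished subgroups $\mathfrak M_n$, $n=0,1,2,\dots$, such that, with $\mathfrak M^{(n)}:=\mathfrak M_0\cdots\mathfrak M_n$ (and $\mathfrak M^{(-1)}:=\{1\}$), we have $\mathfrak M=\bigcup_n\mathfrak M^{(n)}$ and $\mathfrak a\prec\mathfrak b$ for all $m<n$, $\mathfrak a\in\mathfrak M_m$ and $\mathfrak b\in\mathfrak M_n$ with $\mathfrak b\succ 1$. For an ordered abelian group $\mathfrak G$, ${\mathbf k}[[\mathfrak G]]$ is the Hahn field of formal series $f=\sum_{\mathfrak m\in\mathfrak G}f_{\mathfrak m}\mathfrak m$ with coefficients in ${\mathbf k}$ and anti-well-ordered support $\operatorname{supp} f=\{\mathfrak m: f_{\mathfrak m}\neq 0\}$. Put ${\mathbf k}_n:={\mathbf k}[[\mathfrak M^{(n)}]]$ for $n\ge 0$ and ${\mathbf k}_{-1}:={\mathbf k}$; identify ${\mathbf k}_n$ with ${\mathbf k}_{n-1}[[\mathfrak M_n]]$ in the usual way, and let ${\mathbf k}_*:=\bigcup_n{\mathbf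 k}_n$, a subfield of ${\mathbf k}[[\mathfrak M]]$. For every $n$ let a map $c_n:\mathfrak M_n\to{\mathbf k}_{n-1}$ be given with $c_n(\mathfrak m\mathfrak n)=c_n(\mathfrak m)+c_n(\mathfrak n)$. Make ${\mathbf k}_n={\mathbf k}_{n-1}[[\mathfrak M_n]]$ a differential field, by recursion on $n$, with the derivation $$\partial\Big(\sum_{\mathfrak m\in\mathfrak M_n}f_{\mathfrak m}\mathfrak m\Big)=\sum_{\mathfrak m\in\mathfrak M_n}\big(\partial(f_{\mathfrak m})+f_{\mathfrak m}c_n(\mathfrak m)\big)\mathfrak m\qquad(f_{\mathfrak m}\in{\mathbf k}_{n-1}),$$ and give ${\mathbf k}_*$ the derivation that extends the derivations of all ${\mathbf k}_n$. For $S\subseteq{\mathbf k}_*$ put $\operatorname{supp}(S):=\bigcup_{f\in S}\operatorname{supp} f$. Call $S$ truncation closed if for all $f\in S$ and $\mathfrak n\in\mathfrak M$ the truncation $f|_{\mathfrak n}:=\sum_{\mathfrak m\succ\mathfrak n}f_{\mathfrak m}\mathfrak m$ lies in $S$. Call $S$ IL-closed if for all $n$ and all $\mathfrak m_0\in\mathfrak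 M_0,\dots,\mathfrak m_n\in\mathfrak M_n$ with $\mathfrak m_0\cdots\mathfrak m_n\in\operatorname{supp}(S)$ and all $i\in\{1,\dots,n\}$: $\mathfrak m_i\in S$, $\mathfrak m_1\cdots\mathfrak m_n\in S$, and $S$ contains an antiderivative of $c_i(\mathfrak m_i)$ and an antiderivative of $c_1(\mathfrak m_1)+\cdots+c_n(\mathfrak m_n)$ (an antiderivative of $f\in{\mathbf k}_*$ is a $g\in{\mathbf k}_*$ with $\partial(g)=f$). Call $S$ TIL-closed if it is truncation closed and IL-closed. Let ${\mathbf k}\{S\}$ and ${\mathbf k}\langle S\rangle$ be the smallest differential subring and the smallest differential subfield of ${\mathbf k}_*$ containing ${\mathbf k}\cup S$. If $S\subseteq{\mathbf k}_*$ is TIL-closed, then ${\mathbf k}\{S\}$ and ${\mathbf k}\langle S\rangle$ are TIL-closed. -/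

import Mathlib

noncomputable section

namespace IteratedHahn

open HahnSeries Finset

/-! ### Hahn fields over a multiplicative ordered group of monomials -/

/-- The additive group of exponents of an ordered group `G` of monomials, with the *reversed*
order.  Well-ordered sets of exponents are the anti-well-ordered sets of monomials. -/
abbrev Expo (G : Type*) : Type _ := (Additive G)ᵒᵈ

/-- The exponent of a monomial. -/
def expo {G : Type*} (g : G) : Expo G := OrderDual.toDual (Additive.ofMul g)

/-- The monomial with a given exponent. -/
def mono {G : Type*} (γ : Expo G) : G := (OrderDual.ofDual γ).toMul

/-- The monomial in `M` with a given exponent, for exponents of monomials in a subgroup. -/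
def smono {M : Type*} [Group M] {H : Subgroup M} (γ : Expo H) : M := ((mono γ : H) : M)

/-- `k[[G]]`: formal series `∑ f_m m` with anti-well-ordered support in `G`. -/
abbrev Hahn (k G : Type*) [Field k] [CommGroup G] [LinearOrder G] [IsOrderedMonoid G] : Type _ :=
  HahnSeries (Expo G) k

/-- The set of monomials occurring in a series. -/
def supp {k G : Type*} [Field k] [CommGroup G] [LinearOrder G] [IsOrderedMonoid G]
    (f : Hahn k G) : Set G := {m | f.coeff (expo m) ≠ 0}

/-- The truncation of `f` at `n`: the sum of all terms `f_m m` with `n < m`. -/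
def trunc {k G : Type*} [Field k] [CommGroup G] [LinearOrder G] [IsOrderedMonoid G]
    (f : Hahn k G) (n : G) : Hahn k G := truncLT (expo n) f

theorem coeff_trunc {k G : Type*} [Field k] [CommGroup G] [LinearOrder G] [IsOrderedMonoid G]
    (f : Hahn k G) (n m : G) :
    (trunc f n).coeff (expo m) = if n < m then f.coeff (expo m) else 0 := by
  have h : expo m < expo n ↔ n < m := Iff.rfl
  by_cases hm : n < m
  · rw [if_pos hm, trunc, coeff_truncLT_of_lt (h.2 hm)]
  · rw [if_neg hm, trunc, coeff_truncLT_of_le (not_lt.1 (mt h.1 hm))]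

/-! ### The derivation on a Hahn field given by an additive map -/

theorem differential_mul {R : Type*} [CommRing R] (δ : Differential R) (a b : R) :
    δ.deriv (a * b) = a * δ.deriv b + b * δ.deriv a := by
  rw [Derivation.leibniz, smul_eq_mul, smul_eq_mul]

/-- The underlying function of `hahnDeriv`. -/
def hahnDerivFun {Γ R : Type*} [AddCommGroup Γ] [LinearOrder Γ] [IsOrderedAddMonoid Γ] [CommRing R]
    (δ : Differential R) (c : Γ →+ R) (f : R⟦Γ⟧) : R⟦Γ⟧ where
  coeff γ := δ.deriv (f.coeff γ) + f.coeff γ * c γ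
  isPWO_support' := f.isPWO_support.mono fun γ hγ h0 => hγ (by simp [h0])

/-- Given a derivation `δ` on `R` and an additive map `c` from the exponents to `R`, the derivation
`∑ f_γ t^γ ↦ ∑ (δ f_γ + f_γ c(γ)) t^γ` on the Hahn series ring. -/
@[reducible]
def hahnDeriv {Γ R : Type*} [AddCommGroup Γ] [LinearOrder Γ] [IsOrderedAddMonoid Γ] [CommRing R]
    (δ : Differential R) (c : Γ →+ R) : Differential R⟦Γ⟧ := .mk <|
  Derivation.mk'
    (AddMonoidHom.toIntLinearMap
      { toFun := hahnDerivFun δ c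
        map_zero' := by ext; simp [hahnDerivFun]
        map_add' := fun f g => by ext; simp [hahnDerivFun]; ring })
    (by
      have key : ∀ f : R⟦Γ⟧, (hahnDerivFun δ c f).support ⊆ f.support := by
        intro f γ hγ h0
        exact hγ (by simp [hahnDerivFun, h0])
      intro f g
      ext γ
      simp only [AddMonoidHom.coe_toIntLinearMap, AddMonoidHom.coe_mk, ZeroHom.coe_mk,
        smul_eq_mul, coeff_add]
      rw [mul_comm g, coeff_mul_right' g.isPWO_support (key g),
        coeff_mul_left' f.isPWO_support (key f)]
      simp only [hahnDerivFun]
      rw [coeff_mul, map_sum, sum_mul, ← sum_add_distrib, ← sum_add_distrib]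
      refine sum_congr rfl fun ij hij => ?_
      rw [Finset.mem_antidiagonal] at hij
      have hc : c γ = c ij.1 + c ij.2 := by rw [← hij.2.2, map_add]
      rw [hc, Derivation.leibniz]
      simp only [smul_eq_mul]
      ring)

theorem hahnDeriv_coeff {Γ R : Type*} [AddCommGroup Γ] [LinearOrder Γ] [IsOrderedAddMonoid Γ]
    [CommRing R] (δ : Differential R) (c : Γ →+ R) (f : R⟦Γ⟧) (γ : Γ) :
    ((hahnDeriv δ c).deriv f).coeff γ = δ.deriv (f.coeff γ) + f.coeff γ * c γ := rfl

/-! ### Identifying an iterated Hahn field with a Hahn field -/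

/-- If an ordered group `Γ` is the lexicographic sum of `A` (dominant) and `B`, then the iterated
ring of Hahn series with exponents in `A` over Hahn series with exponents in `B` is identified with
the ring of Hahn series with exponents in `Γ`. -/
def glue {A B Γ R : Type*}
    [AddCommGroup A] [LinearOrder A] [IsOrderedAddMonoid A]
    [AddCommGroup B] [LinearOrder B] [IsOrderedAddMonoid B]
    [AddCommGroup Γ] [LinearOrder Γ] [IsOrderedAddMonoid Γ] [CommRing R]
    (e : A ×ₗ B ≃o Γ)
    (he : ∀ a b a' b', e (toLex (a + a', b + b')) = e (toLex (a, b)) + e (toLex (a', b'))) :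
    R⟦B⟧⟦A⟧ ≃+* R⟦Γ⟧ where
  toFun x := embDomain e.toOrderEmbedding (ofIterate x)
  invFun y := toIterate (embDomain e.symm.toOrderEmbedding y)
  left_inv x := by
    have h : embDomain e.symm.toOrderEmbedding (embDomain e.toOrderEmbedding (ofIterate x))
        = ofIterate x := by
      ext p
      have hp : p = e.symm.toOrderEmbedding (e p) := (e.symm_apply_apply p).symm
      conv_lhs => rw [hp]
      rw [embDomain_coeff]
      exact embDomain_coeff (f := e.toOrderEmbedding)
    exact (congrArg toIterate h).trans rfl
  right_inv y := by
    have h : ofIterate (toIterate (embDomain e.symm.toOrderEmbedding y))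
        = embDomain e.symm.toOrderEmbedding y := rfl
    refine (congrArg (embDomain e.toOrderEmbedding) h).trans ?_
    ext g
    have hg : g = e.toOrderEmbedding (e.symm g) := (e.apply_symm_apply g).symm
    conv_lhs => rw [hg]
    rw [embDomain_coeff]
    exact embDomain_coeff (f := e.symm.toOrderEmbedding)
  map_add' x y := by
    ext g
    obtain ⟨p, rfl⟩ := e.surjective g
    have h : ∀ z : R⟦B⟧⟦A⟧, (embDomain e.toOrderEmbedding (ofIterate z)).coeff (e p)
        = (z.coeff p.1).coeff p.2 := fun z => embDomain_coeff (f := e.toOrderEmbedding)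
    rw [coeff_add, h, h, h, coeff_add, coeff_add]
  map_mul' x y := by
    ext g
    obtain ⟨p, rfl⟩ := e.surjective g
    have h : ∀ z : R⟦B⟧⟦A⟧, ∀ p, (embDomain e.toOrderEmbedding (ofIterate z)).coeff (e p)
        = (z.coeff p.1).coeff p.2 := fun z p => embDomain_coeff (f := e.toOrderEmbedding)
    rw [h, coeff_mul, coeff_mul, coeff_sum]
    simp only [coeff_mul]
    rw [sum_sigma']
    refine sum_bij' (fun s _ => (e (toLex (s.1.1, s.2.1)), e (toLex (s.1.2, s.2.2))))
      (fun q _ => ⟨((e.symm q.1).1, (e.symm q.2).1), ((e.symm q.1).2, (e.symm q.2).2)⟩)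
      ?_ ?_ ?_ ?_ ?_
    · rintro ⟨⟨i, j⟩, k, l⟩ hs
      simp only [mem_sigma, Finset.mem_antidiagonal, mem_support] at hs ⊢
      obtain ⟨⟨-, -, hij⟩, hk, hl, hkl⟩ := hs
      refine ⟨by rw [h]; exact hk, by rw [h]; exact hl, ?_⟩
      rw [← he, hij, hkl]
      rfl
    · rintro ⟨u, v⟩ hq
      obtain ⟨u, rfl⟩ := e.surjective u
      obtain ⟨v, rfl⟩ := e.surjective v
      simp only [mem_sigma, Finset.mem_antidiagonal, mem_support, h, e.symm_apply_apply] at hq ⊢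
      obtain ⟨hu, hv, huv⟩ := hq
      have huv' : e (toLex (u.1 + v.1, u.2 + v.2)) = e p := by rw [he]; exact huv
      have hp := e.injective huv'
      refine ⟨⟨ne_zero_of_coeff_ne_zero hu, ne_zero_of_coeff_ne_zero hv, ?_⟩, hu, hv, ?_⟩
      · rw [← hp]; rfl
      · rw [← hp]; rfl
    · rintro ⟨⟨i, j⟩, k, l⟩ hs
      simp only [e.symm_apply_apply]
      rfl
    · rintro ⟨u, v⟩ hq
      exact Prod.ext (e.apply_symm_apply u) (e.apply_symm_apply v)
    · rintro ⟨⟨i, j⟩, k, l⟩ hs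
      simp only [h]
      rfl

theorem glue_coeff {A B Γ R : Type*}
    [AddCommGroup A] [LinearOrder A] [IsOrderedAddMonoid A]
    [AddCommGroup B] [LinearOrder B] [IsOrderedAddMonoid B]
    [AddCommGroup Γ] [LinearOrder Γ] [IsOrderedAddMonoid Γ] [CommRing R]
    (e : A ×ₗ B ≃o Γ)
    (he : ∀ a b a' b', e (toLex (a + a', b + b')) = e (toLex (a, b)) + e (toLex (a', b')))
    (x : R⟦B⟧⟦A⟧) (a : A) (b : B) :
    (glue e he x).coeff (e (toLex (a, b))) = (x.coeff a).coeff b :=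
  embDomain_coeff (f := e.toOrderEmbedding)

/-! ### Chains of monomial groups -/

/-- The subgroup `M_0 ⋯ M_{n-1}` of a commutative group, trivial for `n = 0`. -/
def prodBelow {M : Type*} [CommGroup M] (sub : ℕ → Subgroup M) (n : ℕ) : Subgroup M :=
  ⨆ i ∈ Finset.range n, sub i

/-- An ordered abelian group `M` of monomials with distinguished subgroups `M_0, M_1, …` such that
`M` is the union of the subgroups `M_0 ⋯ M_n`, and every element of `M_m` is smaller than every
element `> 1` of `M_n` whenever `m < n`. -/
structure MonomialChain (M : Type*) [CommGroup M] [LinearOrder M] [IsOrderedMonoid M] where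
  sub : ℕ → Subgroup M
  exhaust : ∀ m : M, ∃ n, m ∈ prodBelow sub (n + 1)
  lt_of_lt : ∀ m n, m < n → ∀ a ∈ sub m, ∀ b ∈ sub n, 1 < b → a < b

namespace MonomialChain

section Chain

variable {M : Type*} [CommGroup M] [LinearOrder M] [IsOrderedMonoid M] (T : MonomialChain M)

/-- `M_0 ⋯ M_{n-1}`, trivial for `n = 0`. -/
def below (n : ℕ) : Subgroup M := prodBelow T.sub n

theorem below_succ (n : ℕ) : T.below (n + 1) = T.below n ⊔ T.sub n := by
  simp only [below, prodBelow, Finset.range_add_one, Finset.iSup_insert]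
  exact sup_comm _ _

theorem sub_le_below_succ (n : ℕ) : T.sub n ≤ T.below (n + 1) := by
  rw [T.below_succ]; exact le_sup_right

theorem below_le_below_succ (n : ℕ) : T.below n ≤ T.below (n + 1) := by
  rw [T.below_succ]; exact le_sup_left

theorem below_lt {n : ℕ} {a : M} (ha : a ∈ T.sub n) (ha1 : 1 < a) :
    ∀ N ≤ n, ∀ b ∈ T.below N, b < a := by
  intro N
  induction N generalizing n a with
  | zero =>
    intro _ b hb
    have hb1 : b = 1 := by simpa [below, prodBelow] using hb
    rwa [hb1]
  | succ N ih =>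
    intro hN b hb
    rw [T.below_succ, Subgroup.mem_sup] at hb
    obtain ⟨x, hx, y, hy, rfl⟩ := hb
    have hxa := ih ha ha1 (by omega) x hx
    rcases lt_or_ge 1 y with h | h
    · have h1 : x < y := ih hy h le_rfl x hx
      have h2 : y * y < a := T.lt_of_lt N n (by omega) _ ((T.sub N).mul_mem hy hy) a ha ha1
      exact (mul_lt_mul_left h1 y).trans h2
    · exact (mul_le_of_le_one_right' h).trans_lt hxa

/-- The exponent group of `M_0 ⋯ M_n` is the lexicographic sum of those of `M_n` (dominant) and
`M_0 ⋯ M_{n-1}`: the pair `(a, b)` corresponds to the monomial `b * a`. -/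
def splitFun (n : ℕ) (p : Expo (T.sub n) ×ₗ Expo (T.below n)) : Expo (T.below (n + 1)) :=
  expo ⟨(smono (ofLex p).2) * (smono (ofLex p).1),
    (T.below (n + 1)).mul_mem (T.below_le_below_succ n (mono (ofLex p).2).2)
      (T.sub_le_below_succ n (mono (ofLex p).1).2)⟩

theorem splitFun_strictMono (n : ℕ) : StrictMono (T.splitFun n) := by
  rintro p q hpq
  have h1 : (smono (ofLex q).2) * (smono (ofLex q).1)
      < (smono (ofLex p).2) * (smono (ofLex p).1) := by
    rcases Prod.Lex.lt_iff.1 hpq with h | ⟨h, h'⟩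
    · have h : (smono (ofLex q).1) < (smono (ofLex p).1) := h
      have h2 : (smono (ofLex q).2) / (smono (ofLex p).2)
          < (smono (ofLex p).1) / (smono (ofLex q).1) :=
        T.below_lt ((T.sub n).div_mem (mono (ofLex p).1).2 (mono (ofLex q).1).2)
          (one_lt_div'.2 h) n le_rfl _
          ((T.below n).div_mem (mono (ofLex q).2).2 (mono (ofLex p).2).2)
      rw [div_lt_div_iff'] at h2
      rwa [mul_comm (smono (ofLex p).2)]
    · have h' : (smono (ofLex q).2) < (smono (ofLex p).2) := h'
      rw [h]
      exact mul_lt_mul_left h' _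
  exact h1

theorem splitFun_surjective (n : ℕ) : Function.Surjective (T.splitFun n) := by
  intro g
  have hg : (smono g) ∈ T.below n ⊔ T.sub n := T.below_succ n ▸ (mono g).2
  obtain ⟨x, hx, y, hy, hxy⟩ := Subgroup.mem_sup.1 hg
  refine ⟨toLex (expo ⟨y, hy⟩, expo ⟨x, hx⟩), ?_⟩
  have : (⟨x * y, hxy ▸ (mono g).2⟩ : T.below (n + 1)) = mono g := Subtype.ext hxy
  exact congrArg expo this

/-- `splitFun` as an isomorphism of ordered sets. -/
def split (n : ℕ) : Expo (T.sub n) ×ₗ Expo (T.below n) ≃o Expo (T.below (n + 1)) :=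
  (T.splitFun_strictMono n).orderIsoOfSurjective _ (T.splitFun_surjective n)

theorem split_add (n : ℕ) (a : Expo (T.sub n)) (b : Expo (T.below n)) (a' : Expo (T.sub n))
    (b' : Expo (T.below n)) :
    T.split n (toLex (a + a', b + b')) = T.split n (toLex (a, b)) + T.split n (toLex (a', b')) := by
  have h : ((smono b) * (smono b')) * ((smono a) * (smono a'))
      = ((smono b) * (smono a)) * ((smono b') * (smono a')) := mul_mul_mul_comm _ _ _ _
  have h' : mono (T.split n (toLex (a + a', b + b')))
      = mono (T.split n (toLex (a, b)) + T.split n (toLex (a', b'))) := Subtype.ext h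
  exact h'

end Chain

/-! ### The fields `k_n`, their union `k_*`, and the induced derivation -/

section Field

variable {k : Type*} [Field k] {M : Type*} [CommGroup M] [LinearOrder M] [IsOrderedMonoid M]
  (T : MonomialChain M)

/-- The identification of `k_{n-1}[[M_n]]` with `k_n = k[[M_0 ⋯ M_n]]`, where
`k_{n-1} = k[[M_0 ⋯ M_{n-1}]]` and `k_{-1} = k[[1]] = k`. -/
def identify (n : ℕ) :
    HahnSeries (Expo (T.sub n)) (Hahn k (T.below n)) ≃+* Hahn k (T.below (n + 1)) :=
  glue (T.split n) (T.split_add n)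

/-- The inclusion of `k[[M_0 ⋯ M_{n-1}]]` in `k[[M]]`. -/
def incl (n : ℕ) : Hahn k (T.below n) →+* Hahn k M :=
  embDomainRingHom
    { toFun := fun γ => expo (smono γ)
      map_zero' := rfl
      map_add' := fun _ _ => rfl }
    (fun _ _ h => congrArg expo (Subtype.ext h))
    (fun _ _ => Iff.rfl)

theorem incl_coeff (n : ℕ) (f : Hahn k (T.below n)) (γ : Expo (T.below n)) :
    (T.incl n f).coeff (expo (smono γ)) = f.coeff γ :=
  embDomain_mk_coeff (f := fun γ : Expo (T.below n) => (expo (smono γ) : Expo M))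
    (fun _ _ h => congrArg expo (Subtype.ext h)) (fun _ _ => Iff.rfl)

theorem incl_coeff_of_notMem (n : ℕ) (f : Hahn k (T.below n)) (γ : Expo M)
    (h : mono γ ∉ T.below n) : (T.incl n f).coeff γ = 0 := by
  refine embDomain_of_notMem_range (f := ⟨⟨fun γ : Expo (T.below n) => (expo (smono γ) : Expo M),
    fun _ _ h => congrArg expo (Subtype.ext h)⟩, Iff.rfl⟩) ?_
  rintro ⟨η, rfl⟩
  exact h (mono η).2

/-- The inclusion of `k_{n-1}` in `k_n = k_{n-1}[[M_n]]` as coefficient field. -/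
def step (n : ℕ) : Hahn k (T.below n) →+* Hahn k (T.below (n + 1)) :=
  (T.identify n).toRingHom.comp (C : Hahn k (T.below n) →+* _)

theorem incl_step (n : ℕ) (f : Hahn k (T.below n)) :
    T.incl (n + 1) (T.step n f) = T.incl n f := by
  ext γ
  by_cases h : mono γ ∈ T.below (n + 1)
  · obtain ⟨p, hp⟩ := T.splitFun_surjective n (expo ⟨mono γ, h⟩)
    have h1 : (T.incl (n + 1) (T.step n f)).coeff γ
        = ((C f : HahnSeries (Expo (T.sub n)) (Hahn k (T.below n))).coeff (ofLex p).1).coeff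
            (ofLex p).2 := by
      refine (T.incl_coeff (n + 1) (T.step n f) (expo ⟨mono γ, h⟩)).trans ?_
      rw [← hp]
      exact glue_coeff (T.split n) (T.split_add n) _ _ _
    have h2 : (smono (ofLex p).2) * (smono (ofLex p).1) = mono γ :=
      congrArg (fun x => smono x) hp
    rw [h1]
    by_cases h0 : (ofLex p).1 = 0
    · have h3 : (smono (ofLex p).1) = 1 := by rw [h0]; rfl
      rw [h3, mul_one] at h2
      have h4 : γ = expo (smono (ofLex p).2) := congrArg expo h2.symm
      rw [h0, h4, T.incl_coeff n]
      simp
    · have h3 : mono γ ∉ T.below n := by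
        intro hm
        have hy : (smono (ofLex p).1) ∈ T.below n := by
          have := (T.below n).mul_mem ((T.below n).inv_mem (mono (ofLex p).2).2) hm
          rw [← h2] at this
          exact (inv_mul_cancel_left (smono (ofLex p).2) (smono (ofLex p).1)) ▸ this
        have hne : (smono (ofLex p).1) ≠ 1 := fun h1 =>
          h0 (congrArg expo (Subtype.ext h1 : mono (ofLex p).1 = (1 : T.sub n)))
        rcases lt_or_gt_of_ne hne with hlt | hgt
        · exact lt_irrefl _ (T.below_lt ((T.sub n).inv_mem (mono (ofLex p).1).2)
            (one_lt_inv'.2 hlt) n le_rfl _ ((T.below n).inv_mem hy))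
        · exact lt_irrefl _ (T.below_lt (mono (ofLex p).1).2 hgt n le_rfl _ hy)
      rw [T.incl_coeff_of_notMem n f γ h3]
      simp [h0]
  · rw [T.incl_coeff_of_notMem _ _ _ h,
      T.incl_coeff_of_notMem _ _ _ fun h' => h (T.below_le_below_succ n h')]

theorem exists_incl_eq {m n : ℕ} (hmn : m ≤ n) (f : Hahn k (T.below m)) :
    ∃ g : Hahn k (T.below n), T.incl n g = T.incl m f := by
  induction n, hmn using Nat.le_induction with
  | base => exact ⟨f, rfl⟩
  | succ n _ ih =>
    obtain ⟨g, hg⟩ := ih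
    exact ⟨T.step n g, by rw [T.incl_step, hg]⟩

variable (k) in
/-- The field `k_* = ⋃ k_n`, a subfield of `k[[M]]`. -/
def kStar : Subfield (Hahn k M) where
  carrier := {f | ∃ n, ∃ g : Hahn k (T.below n), T.incl n g = f}
  mul_mem' := by
    rintro _ _ ⟨m, f, rfl⟩ ⟨n, g, rfl⟩
    obtain ⟨f', hf⟩ := T.exists_incl_eq (le_max_left m n) f
    obtain ⟨g', hg⟩ := T.exists_incl_eq (le_max_right m n) g
    exact ⟨max m n, f' * g', by rw [map_mul, hf, hg]⟩
  one_mem' := ⟨0, 1, map_one _⟩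
  add_mem' := by
    rintro _ _ ⟨m, f, rfl⟩ ⟨n, g, rfl⟩
    obtain ⟨f', hf⟩ := T.exists_incl_eq (le_max_left m n) f
    obtain ⟨g', hg⟩ := T.exists_incl_eq (le_max_right m n) g
    exact ⟨max m n, f' + g', by rw [map_add, hf, hg]⟩
  zero_mem' := ⟨0, 0, map_zero _⟩
  neg_mem' := by
    rintro _ ⟨m, f, rfl⟩
    exact ⟨m, -f, map_neg _ _⟩
  inv_mem' := by
    rintro _ ⟨m, f, rfl⟩
    exact ⟨m, f⁻¹, map_inv₀ _ _⟩

/-- The inclusion of `k[[M_0 ⋯ M_{n-1}]]` in `k_*`. -/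
def toStar (n : ℕ) : Hahn k (T.below n) →+* T.kStar k :=
  (T.incl n).codRestrict (T.kStar k) fun g => ⟨n, g, rfl⟩

/-- The inclusion of `k` in `k_*`. -/
def const : k →+* T.kStar k := (T.toStar 0).comp C

/-- The monomial `m`, as an element of `k_*`. -/
def monomial (m : M) : T.kStar k :=
  ⟨single (expo m) 1, by
    obtain ⟨n, hn⟩ := T.exhaust m
    refine ⟨n + 1, single (expo ⟨m, hn⟩) 1, ?_⟩
    exact embDomain_single (f := ⟨⟨fun γ : Expo (T.below (n + 1)) => (expo (smono γ) : Expo M),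
      fun _ _ h => congrArg expo (Subtype.ext h)⟩, Iff.rfl⟩)⟩

theorem exists_toStar_eq₂ (f g : T.kStar k) :
    ∃ n, ∃ f' g' : Hahn k (T.below n), T.toStar n f' = f ∧ T.toStar n g' = g := by
  obtain ⟨_, m, f, rfl⟩ := f
  obtain ⟨_, n, g, rfl⟩ := g
  obtain ⟨f', hf⟩ := T.exists_incl_eq (le_max_left m n) f
  obtain ⟨g', hg⟩ := T.exists_incl_eq (le_max_right m n) g
  exact ⟨max m n, f', g', Subtype.ext hf, Subtype.ext hg⟩

variable [Differential k]

/-- The derivation on `k[[M_0 ⋯ M_{n-1}]]`, by recursion: for `n = 0` it is the derivation of `k`,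
and on `k[[M_0 ⋯ M_n]] = k_{n-1}[[M_n]]` it is given by the derivation of `k_{n-1}` and the additive
map `c n : M_n → k_{n-1}`. -/
@[reducible]
def derivLevel (c : ∀ n, Additive (T.sub n) →+ Hahn k (T.below n)) :
    ∀ n, Differential (Hahn k (T.below n))
  | 0 => hahnDeriv inferInstance 0
  | n + 1 =>
    letI : Differential (HahnSeries (Expo (T.sub n)) (Hahn k (T.below n))) :=
      hahnDeriv (derivLevel c n)
        { toFun := fun γ => c n (OrderDual.ofDual γ)
          map_zero' := map_zero (c n)
          map_add' := fun γ η => map_add (c n) (OrderDual.ofDual γ) (OrderDual.ofDual η) }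
    Differential.equiv (T.identify n).symm

theorem derivLevel_step (c : ∀ n, Additive (T.sub n) →+ Hahn k (T.below n)) (n : ℕ)
    (f : Hahn k (T.below n)) :
    (T.derivLevel c (n + 1)).deriv (T.step n f) = T.step n ((T.derivLevel c n).deriv f) := by
  have h : ∀ x : HahnSeries (Expo (T.sub n)) (Hahn k (T.below n)),
      (T.identify n).symm (T.identify n x) = x := (T.identify n).symm_apply_apply
  change T.identify n ((hahnDeriv (T.derivLevel c n) _).deriv ((T.identify n).symm
    (T.identify n (C f)))) = T.identify n (C ((T.derivLevel c n).deriv f))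
  rw [h]
  congr 1
  ext1
  funext γ
  rw [hahnDeriv_coeff]
  by_cases h0 : γ = 0
  · rw [h0, map_zero]; simp
  · simp [h0]

theorem toStar_derivLevel_congr (c : ∀ n, Additive (T.sub n) →+ Hahn k (T.below n)) {m n : ℕ}
    (f : Hahn k (T.below m)) (g : Hahn k (T.below n)) (hfg : T.toStar m f = T.toStar n g) :
    T.toStar m ((T.derivLevel c m).deriv f) = T.toStar n ((T.derivLevel c n).deriv g) := by
  have inj : ∀ n, Function.Injective (T.toStar (k := k) n) := fun n f g h =>
    HahnSeries.embDomain_injective (congrArg Subtype.val h)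
  have hstep : ∀ n (f : Hahn k (T.below n)), T.toStar (n + 1) (T.step n f) = T.toStar n f :=
    fun n f => Subtype.ext (T.incl_step n f)
  have lift : ∀ {m n : ℕ}, m ≤ n → ∀ f : Hahn k (T.below m), ∃ g : Hahn k (T.below n),
      T.toStar n g = T.toStar m f ∧
        T.toStar n ((T.derivLevel c n).deriv g) = T.toStar m ((T.derivLevel c m).deriv f) := by
    intro m n hmn f
    induction n, hmn using Nat.le_induction with
    | base => exact ⟨f, rfl, rfl⟩
    | succ n _ ih =>
      obtain ⟨g, hg, hg'⟩ := ih
      exact ⟨T.step n g, by rw [hstep, hg], by rw [derivLevel_step, hstep, hg']⟩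
  obtain ⟨f', hf, hf'⟩ := lift (le_max_left m n) f
  obtain ⟨g', hg, hg'⟩ := lift (le_max_right m n) g
  have : f' = g' := inj _ (by rw [hf, hg, hfg])
  rw [← hf', ← hg', this]

/-- The underlying function of `deriv`: the derivative of an element of `k_n` is computed in `k_n`
(for any `n`, see `toStar_derivLevel_congr`). -/
def derivFun (c : ∀ n, Additive (T.sub n) →+ Hahn k (T.below n)) (f : T.kStar k) : T.kStar k :=
  T.toStar f.2.choose ((T.derivLevel c f.2.choose).deriv f.2.choose_spec.choose)

theorem derivFun_toStar (c : ∀ n, Additive (T.sub n) →+ Hahn k (T.below n)) (n : ℕ)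
    (f : Hahn k (T.below n)) :
    T.derivFun c (T.toStar n f) = T.toStar n ((T.derivLevel c n).deriv f) :=
  T.toStar_derivLevel_congr c _ _ (Subtype.ext (T.toStar n f).2.choose_spec.choose_spec)

/-- The structure of a differential field on `k_*` that extends the derivations of all `k_n`. -/
@[reducible]
def differential (c : ∀ n, Additive (T.sub n) →+ Hahn k (T.below n)) :
    Differential (T.kStar k) := .mk <|
  Derivation.mk'
    (AddMonoidHom.toIntLinearMap
      { toFun := T.derivFun c
        map_zero' := by rw [← map_zero (T.toStar 0), derivFun_toStar, map_zero]
        map_add' := fun f g => by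
          obtain ⟨n, f, g, rfl, rfl⟩ := T.exists_toStar_eq₂ f g
          rw [← map_add, derivFun_toStar, derivFun_toStar, derivFun_toStar, map_add, map_add] })
    (by
      intro f g
      obtain ⟨n, f, g, rfl, rfl⟩ := T.exists_toStar_eq₂ f g
      change T.derivFun c _ = _ * T.derivFun c _ + _ * T.derivFun c _
      have h : (T.derivLevel c n).deriv (f * g)
          = f * (T.derivLevel c n).deriv g + g * (T.derivLevel c n).deriv f :=
        differential_mul _ f g
      rw [← map_mul, derivFun_toStar, derivFun_toStar, derivFun_toStar, h, map_add, map_mul,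
        map_mul])

/-- The derivation of `k_*`. -/
def deriv (c : ∀ n, Additive (T.sub n) →+ Hahn k (T.below n)) (f : T.kStar k) : T.kStar k :=
  (T.differential c).deriv f

theorem deriv_toStar (c : ∀ n, Additive (T.sub n) →+ Hahn k (T.below n)) (n : ℕ)
    (f : Hahn k (T.below n)) : T.deriv c (T.toStar n f) = T.toStar n ((T.derivLevel c n).deriv f) :=
  T.derivFun_toStar c n f

/-- For `m ∈ M_n`, the element `c_n(m)` of `k_{n-1}`, viewed in `k_*`. -/
def cStar (c : ∀ n, Additive (T.sub n) →+ Hahn k (T.below n)) (n : ℕ) (m : T.sub n) : T.kStar k :=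
  T.toStar n (c n (Additive.ofMul m))

/-! ### TIL-closed sets and generated differential rings and fields -/

/-- `S ⊆ k_*` is truncation closed, as a subset of `k[[M]]`. -/
def TruncationClosed (S : Set (T.kStar k)) : Prop :=
  ∀ f ∈ S, ∀ n : M, ∃ g ∈ S, (g : Hahn k M) = trunc (f : Hahn k M) n

/-- `S` contains an antiderivative of `f`. -/
def HasIntegralIn (c : ∀ n, Additive (T.sub n) →+ Hahn k (T.below n)) (S : Set (T.kStar k))
    (f : T.kStar k) : Prop :=
  ∃ g ∈ S, T.deriv c g = f

/-- `S ⊆ k_*` is iteratively-logarithmically closed: whenever `m_0 ⋯ m_n` (with `m_i ∈ M_i`) occurs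
in the support of an element of `S`, then `S` contains `m_i` and an antiderivative of `c_i(m_i)` for
`1 ≤ i ≤ n`, as well as `m_1 ⋯ m_n` and an antiderivative of `c_1(m_1) + ⋯ + c_n(m_n)`. -/
def ILClosed (c : ∀ n, Additive (T.sub n) →+ Hahn k (T.below n)) (S : Set (T.kStar k)) : Prop :=
  ∀ (n : ℕ) (m : ∀ i, T.sub i),
    (∃ f ∈ S, ∏ i ∈ Finset.range (n + 1), (m i : M) ∈ supp (f : Hahn k M)) →
    ∀ i ∈ Finset.Icc 1 n,
      T.HasIntegralIn c S (T.cStar c i (m i)) ∧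
      T.monomial (m i : M) ∈ S ∧
      T.HasIntegralIn c S (∑ j ∈ Finset.Icc 1 n, T.cStar c j (m j)) ∧
      T.monomial (∏ j ∈ Finset.Icc 1 n, (m j : M)) ∈ S

/-- `S ⊆ k_*` is TIL-closed: truncation closed and iteratively-logarithmically closed. -/
def TILClosed (c : ∀ n, Additive (T.sub n) →+ Hahn k (T.below n)) (S : Set (T.kStar k)) : Prop :=
  T.TruncationClosed S ∧ T.ILClosed c S

/-- `k{S}`: the smallest differential subring of `k_*` that contains `k` and `S`. -/
def diffRing (c : ∀ n, Additive (T.sub n) →+ Hahn k (T.below n)) (S : Set (T.kStar k)) :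
    Subring (T.kStar k) :=
  sInf {R | (∀ a : k, T.const a ∈ R) ∧ S ⊆ R ∧ ∀ f ∈ R, T.deriv c f ∈ R}

/-- `k⟨S⟩`: the smallest differential subfield of `k_*` that contains `k` and `S`. -/
def diffField (c : ∀ n, Additive (T.sub n) →+ Hahn k (T.below n)) (S : Set (T.kStar k)) :
    Subfield (T.kStar k) :=
  sInf {F | (∀ a : k, T.const a ∈ F) ∧ S ⊆ F ∧ ∀ f ∈ F, T.deriv c f ∈ F}

end Field

end MonomialChain

end IteratedHahn

end

noncomputable section

namespace IteratedHahn

open HahnSeries Finset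

/-! ### Truncations of Hahn series and induction on them. -/

section Truncation

variable {Γ R : Type*} [LinearOrder Γ]

/-! Let `A` be `k{S}` or `k⟨S⟩` and let `V` be the additive group generated by `S`. Call `m ∈ M_i`
admissible if `i = 0`, or if `m ∈ A` and `V` contains an antiderivative of `c_i(m)`; let `L` be the
monoid of products of admissible monomials. The object to study is `core A L`: the elements of `A`
with all truncations in `A` and support in `L`. It contains `k`, and it contains `S` because `S` is
TIL-closed. If it is also a differential subring (subfield in the second case), minimality of `A`
gives `A ⊆ core A L`. That inclusion is TIL-closedness of `A` in disguise: factorizations of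
monomials are unique, so the factors of a monomial in a support are admissible, and products and
sums over the factors follow (`tilClosed_of_subset_core`).

Closure under multiplication and inversion is a matter of Hahn series alone. If two tails multiply
into exponents beyond the cut, then the truncated product is expressed by truncated products with
shorter factors (`truncLT_mul_of_le`), and well-founded induction finishes (`truncLT_mul_mem`,
`truncLT_inv_mem`).

Closure under the derivation (`deriv_mem_core`) is the heart. On a coset of `M_0 ⋯ M_j`, the
operator `y(f) = f' - d f`, with `d` the logarithmic derivative of a monomial `μ` of that coset,
moves monomials only inside cosets of `M_0 ⋯ M_{j-1}`. Cutting `f` at `n` into the parts above, in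
and below the coset of `n` therefore confines the problem to the middle part, which lives on a
smaller coset: induction on `j` (`deriv_mem_core_of_coset`). This needs `d` in the core, that is,
`c_r(a)` in the core for admissible `a`. Since `c_r(a)` lies in `k_{r-1}`, its antiderivative in `V`
can be taken in `k_{r-1}` as well (`exists_integral_in_below`), where closure under the derivation
is already known: induction on `r`. -/

theorem truncLT_truncLT [Zero R] (m n : Γ) (f : R⟦Γ⟧) :
    truncLT m (truncLT n f) = truncLT (min m n) f := by
  ext γ
  simp only [HahnSeries.coeff_truncLT, lt_min_iff]
  split_ifs <;> tauto

theorem truncLT_eq_self [Zero R] {n : Γ} {f : R⟦Γ⟧} (h : ∀ γ ∈ f.support, γ < n) :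
    truncLT n f = f := by
  ext γ
  rw [HahnSeries.coeff_truncLT]
  split_ifs with hγ
  · rfl
  · by_contra h0
    exact hγ (h γ (Ne.symm h0))

theorem truncLT_eq_zero [Zero R] {n : Γ} {f : R⟦Γ⟧} (h : ∀ γ ∈ f.support, n ≤ γ) :
    truncLT n f = 0 := by
  ext γ
  rw [HahnSeries.coeff_truncLT]
  split_ifs with hγ
  · by_contra h0
    exact (h γ h0).not_gt hγ
  · rfl

theorem truncLT_neg [AddGroup R] (n : Γ) (f : R⟦Γ⟧) : truncLT n (-f) = -truncLT n f := by
  ext γ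
  simp only [HahnSeries.coeff_truncLT, coeff_neg]
  split_ifs <;> simp

theorem truncLT_sub [AddGroup R] (n : Γ) (f g : R⟦Γ⟧) :
    truncLT n (f - g) = truncLT n f - truncLT n g := by
  rw [sub_eq_add_neg, truncLT_add, truncLT_neg, sub_eq_add_neg]

/-- Induction on series: a property holds for `f` if it passes to `f` from its proper
truncations. -/
theorem truncation_induction [Zero R] {P : R⟦Γ⟧ → Prop}
    (step : ∀ f, (∀ γ ∈ f.support, P (truncLT γ f)) → P f) (f : R⟦Γ⟧) : P f := by
  refine step f fun γ hγ => ?_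
  refine f.isWF_support.induction (P := fun γ => P (truncLT γ f)) hγ fun γ hγ ih => ?_
  refine step _ fun δ hδ => ?_
  rw [mem_support, HahnSeries.coeff_truncLT] at hδ
  split_ifs at hδ with h
  · rw [truncLT_truncLT, min_eq_left h.le]
    exact ih δ hδ h
  · exact absurd rfl hδ

end Truncation

/-! ### Truncations of products. -/

section Ring

variable {Γ R : Type*} [AddCommGroup Γ] [LinearOrder Γ] [IsOrderedAddMonoid Γ] [CommRing R]

/-- The tails `f - truncLT a f` and `g - truncLT b g` have exponents at least `a` and `b`, so their
product vanishes under truncation at `n`; expanding it gives the formula. Each product on the right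
has a shortened factor, which is what drives the inductions for products and inverses. -/
theorem truncLT_mul_of_le {a b n : Γ} (h : n ≤ a + b) (f g : R⟦Γ⟧) :
    truncLT n (f * g) = truncLT n (truncLT a f * g) + truncLT n (f * truncLT b g)
      - truncLT n (truncLT a f * truncLT b g) := by
  have h0 : truncLT n ((f - truncLT a f) * (g - truncLT b g)) = 0 := by
    refine truncLT_eq_zero fun γ hγ => ?_
    obtain ⟨α, hα, β, hβ, rfl⟩ := Set.mem_add.1 (support_mul_subset hγ)
    have key : ∀ (c x : Γ) (u : R⟦Γ⟧), x ∈ (u - truncLT c u).support → c ≤ x := by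
      intro c x u hx
      by_contra hlt
      exact hx (by rw [coeff_sub, coeff_truncLT_of_lt (not_le.1 hlt), sub_self])
    exact h.trans (add_le_add (key _ _ _ hα) (key _ _ _ hβ))
  have h1 : f * g = (f - truncLT a f) * (g - truncLT b g)
      + (truncLT a f * g + f * truncLT b g - truncLT a f * truncLT b g) := by ring
  rw [h1, truncLT_add, h0, zero_add, truncLT_sub, truncLT_add]

/-- If the truncations of `f` and `g` lie in a subring, then so do those of `f * g`. -/
theorem truncLT_mul_mem (A : Subring R⟦Γ⟧) (f g : R⟦Γ⟧) (hf : f ∈ A) (hf' : ∀ n, truncLT n f ∈ A)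
    (hg : g ∈ A) (hg' : ∀ n, truncLT n g ∈ A) (n : Γ) : truncLT n (f * g) ∈ A := by
  have her : ∀ (u : R⟦Γ⟧) (a : Γ), (∀ n, truncLT n u ∈ A) → ∀ n, truncLT n (truncLT a u) ∈ A :=
    fun u a hu n => by rw [truncLT_truncLT]; exact hu _
  induction f using truncation_induction generalizing g with
  | step f ihf =>
  induction g using truncation_induction with
  | step g ihg =>
  by_cases h : ∃ a ∈ f.support, ∃ b ∈ g.support, n ≤ a + b
  · obtain ⟨a, ha, b, hb, hab⟩ := h
    rw [truncLT_mul_of_le hab]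
    exact A.sub_mem (A.add_mem (ihf a ha g (hf' a) (her f a hf') hg hg')
      (ihg b hb (hg' b) (her g b hg')))
      (ihf a ha _ (hf' a) (her f a hf') (hg' b) (her g b hg'))
  · push Not at h
    rw [truncLT_eq_self]
    · exact A.mul_mem hf hg
    · intro γ hγ
      obtain ⟨a, ha, b, hb, rfl⟩ := Set.mem_add.1 (support_mul_subset hγ)
      exact h a ha b hb

/-- The elements of a subring all of whose truncations lie in the subring. -/
def truncationCore (A : Subring R⟦Γ⟧) (hA : ∀ n : Γ, truncLT n (1 : R⟦Γ⟧) ∈ A) :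
    Subring R⟦Γ⟧ where
  carrier := {f | f ∈ A ∧ ∀ n, truncLT n f ∈ A}
  mul_mem' hf hg :=
    ⟨A.mul_mem hf.1 hg.1, fun n => truncLT_mul_mem A _ _ hf.1 hf.2 hg.1 hg.2 n⟩
  one_mem' := ⟨A.one_mem, hA⟩
  add_mem' hf hg := ⟨A.add_mem hf.1 hg.1, fun n => by
    rw [truncLT_add]; exact A.add_mem (hf.2 n) (hg.2 n)⟩
  zero_mem' := ⟨A.zero_mem, fun n => by rw [map_zero]; exact A.zero_mem⟩
  neg_mem' hf := ⟨A.neg_mem hf.1, fun n => by rw [truncLT_neg]; exact A.neg_mem (hf.2 n)⟩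

theorem truncLT_single_mem (A : Subring R⟦Γ⟧) {γ : Γ} {r : R} (h : single γ r ∈ A) (n : Γ) :
    truncLT n (single γ r) ∈ A := by
  by_cases hn : γ < n
  · rw [truncLT_eq_self]
    · exact h
    · intro δ hδ
      rwa [support_single_subset hδ]
  · rw [truncLT_eq_zero]
    · exact A.zero_mem
    · intro δ hδ
      rw [support_single_subset hδ]
      exact not_lt.1 hn

end Ring

/-! ### Truncations of inverses. -/

section Field

variable {Γ R : Type*} [AddCommGroup Γ] [LinearOrder Γ] [IsOrderedAddMonoid Γ] [Field R]

/-- If `f` and its truncations lie in a subfield, then so do the truncations of `f⁻¹`. -/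
theorem truncLT_inv_mem (A : Subfield R⟦Γ⟧) (f : R⟦Γ⟧) (hf : f ∈ A) (hf' : ∀ n, truncLT n f ∈ A)
    (n : Γ) : truncLT n f⁻¹ ∈ A := by
  rcases eq_or_ne f 0 with rfl | h0
  · rw [inv_zero, map_zero]; exact A.zero_mem
  have hg := (A.inv_mem hf)
  generalize hgdef : f⁻¹ = g at hg
  have hfg : f * g = 1 := by rw [← hgdef, mul_inv_cancel₀ h0]
  clear hgdef
  suffices H : ∀ g', (∃ n, g' = truncLT n g) → g' ∈ A from H _ ⟨n, rfl⟩
  intro g'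
  induction g' using truncation_induction with
  | step g' ihg =>
  rintro ⟨n, rfl⟩
  set g' := truncLT n g with hg'
  have gsupp : ∀ b ∈ g'.support, b < n := by
    intro b hb
    by_contra h
    exact hb (coeff_truncLT_of_le (not_lt.1 h) g)
  -- Shorten `f` while keeping its leading term, until `f' * g'` has no exponents beyond `f.order +
  -- n`. Then `f' * g'` itself lies in `A`, and dividing by `f'` yields `g'`.
  have main : ∀ f' : R⟦Γ⟧, f'.coeff f.order ≠ 0 → (∀ a ∈ f'.support, f.order ≤ a) → f' ∈ A →
      (∀ m, truncLT m f' ∈ A) → truncLT (f.order + n) (f' * g') ∈ A → g' ∈ A := by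
    intro f'
    induction f' using truncation_induction with
    | step f' ih =>
    intro h1 h2 h3 h4 h5
    by_cases h : ∃ a ∈ f'.support, ∃ b ∈ g'.support, f.order + n ≤ a + b
    · obtain ⟨a, ha, b, hb, hab⟩ := h
      -- Exponents of `g'` are below `n`, so `a` must exceed `f.order`, and truncating `f'` at `a`
      -- preserves its leading term.
      have hlt : f.order < a := by
        by_contra hle
        exact (add_lt_add_of_le_of_lt (not_lt.1 hle) (gsupp b hb)).not_ge hab
      have hgb : ∀ m, truncLT m (truncLT b g') ∈ A := by
        intro m
        rw [truncLT_truncLT]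
        rcases le_total m b with hmb | hmb
        · rw [min_eq_left hmb]
          -- The induction hypothesis covers only cuts at exponents of the support, so `m` is moved
          -- up to the next such exponent `c`, which exists because `m ≤ b`.
          by_cases hm : ∃ c ∈ g'.support, m ≤ c ∧ ∀ d ∈ g'.support, m ≤ d → c ≤ d
          · obtain ⟨c, hc, hmc, hcd⟩ := hm
            have : truncLT m g' = truncLT c g' := by
              ext γ
              rw [HahnSeries.coeff_truncLT m g', HahnSeries.coeff_truncLT c g']
              split_ifs with u v v
              · rfl
              · exact absurd (u.trans_le hmc) v
              · by_contra hne
                exact (hcd γ (fun h => hne h.symm) (not_lt.1 u)).not_gt v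
              · rfl
            rw [this]
            exact ihg c hc ⟨min c n, by rw [hg', truncLT_truncLT]⟩
          · exfalso
            have hne : (g'.support ∩ Set.Ici m).Nonempty := ⟨b, hb, hmb⟩
            have hwf : (g'.support ∩ Set.Ici m).IsWF := g'.isWF_support.mono Set.inter_subset_left
            exact hm ⟨hwf.min hne, (hwf.min_mem hne).1, (hwf.min_mem hne).2,
              fun d hd hmd => hwf.min_le hne ⟨hd, hmd⟩⟩
        · rw [min_eq_right hmb]
          exact ihg b hb ⟨min b n, by rw [hg', truncLT_truncLT]⟩
      have hgb' : truncLT b g' ∈ A := by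
        have := hgb b
        rwa [truncLT_truncLT, min_self] at this
      refine ih a ha ?_ ?_ (h4 a) ?_ ?_
      · rwa [coeff_truncLT_of_lt hlt]
      · intro x hx
        refine h2 x fun hx0 => hx ?_
        rw [HahnSeries.coeff_truncLT, hx0, ite_self]
      · intro m; rw [truncLT_truncLT]; exact h4 _
      · have e1 := truncLT_mul_of_le hab f' g'
        have e2 : truncLT (f.order + n) (truncLT a f' * g') = truncLT (f.order + n) (f' * g')
            - truncLT (f.order + n) (f' * truncLT b g')
            + truncLT (f.order + n) (truncLT a f' * truncLT b g') := by
          rw [e1]; abel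
        rw [e2]
        refine A.add_mem (A.sub_mem h5 ?_) ?_
        · exact truncLT_mul_mem A.toSubring _ _ h3 h4 hgb' hgb _
        · refine truncLT_mul_mem A.toSubring _ _ (h4 a) ?_ hgb' hgb _
          intro m; rw [truncLT_truncLT]; exact h4 _
    · push Not at h
      rw [truncLT_eq_self] at h5
      · have hne : f' ≠ 0 := by rintro rfl; exact h1 rfl
        have := A.mul_mem (A.inv_mem h3) h5
        rwa [inv_mul_cancel_left₀ hne] at this
      · intro γ hγ
        obtain ⟨a, ha, b, hb, rfl⟩ := Set.mem_add.1 (support_mul_subset hγ)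
        exact h a ha b hb
  refine main f (coeff_order_eq_zero.not.2 h0) (fun a ha => order_le_of_coeff_ne_zero ha) hf hf' ?_
  -- Replacing `g` by `g'` changes `f * g = 1` only at exponents from `f.order + n` on.
  have e : truncLT (f.order + n) (f * g') = truncLT (f.order + n) (single 0 1) := by
    have h1 : truncLT (f.order + n) (f * (g - g')) = 0 := by
      refine truncLT_eq_zero fun γ hγ => ?_
      obtain ⟨a, ha, b, hb, rfl⟩ := Set.mem_add.1 (support_mul_subset hγ)
      refine add_le_add (order_le_of_coeff_ne_zero ha) ?_
      by_contra hlt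
      exact hb (by rw [coeff_sub, hg', coeff_truncLT_of_lt (not_le.1 hlt), sub_self])
    rw [mul_sub, truncLT_sub, sub_eq_zero, hfg] at h1
    exact h1.symm
  rw [e]
  exact truncLT_single_mem A.toSubring A.one_mem _

end Field

/-! ### Supports, and series supported in a submonoid or subgroup. -/

section Support

variable {Γ Γ' R : Type*} [LinearOrder Γ] [LinearOrder Γ'] [Zero R]

/-- A series supported in the range of an order embedding is an embedded series. -/
theorem exists_embDomain_eq (e : Γ' ↪o Γ) (f : R⟦Γ⟧) (h : f.support ⊆ Set.range e) :
    ∃ g : R⟦Γ'⟧, embDomain e g = f := by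
  refine ⟨⟨fun γ => f.coeff (e γ), ?_⟩, ?_⟩
  · have := f.isWF_support
    refine Set.IsWF.isPWO ?_
    have h2 : (e ⁻¹' f.support).IsWF := by
      rw [Set.isWF_iff_no_descending_seq] at this ⊢
      intro s hs hmem
      exact this (e ∘ s) (fun a b hab => e.strictMono (hs hab)) (fun n => hmem n)
    exact h2
  · ext γ
    by_cases hγ : γ ∈ Set.range e
    · obtain ⟨δ, rfl⟩ := hγ
      rw [embDomain_coeff]
    · rw [embDomain_of_notMem_range hγ]
      by_contra h0
      exact hγ (h (Ne.symm h0))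

end Support

theorem differential_one {R : Type*} [CommRing R] (δ : Differential R) : δ.deriv (1 : R) = 0 :=
  Derivation.map_one_eq_zero _

section Supp

variable {k G : Type*} [Field k] [CommGroup G] [LinearOrder G] [IsOrderedMonoid G]

theorem mem_supp {f : Hahn k G} {m : G} : m ∈ supp f ↔ f.coeff (expo m) ≠ 0 := Iff.rfl

theorem coeff_eq_zero_of_notMem_supp {f : Hahn k G} {m : G} (h : m ∉ supp f) :
    f.coeff (expo m) = 0 := not_not.1 h

theorem supp_eq_empty {f : Hahn k G} : supp f = ∅ ↔ f = 0 := by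
  refine ⟨fun h => ?_, fun h => ?_⟩
  · ext γ
    exact not_not.1 (Set.eq_empty_iff_forall_notMem.1 h (mono γ))
  · rw [h]; exact Set.eq_empty_iff_forall_notMem.2 fun m hm => hm rfl

theorem exists_of_mem_supp_mul {f g : Hahn k G} {m : G} (h : m ∈ supp (f * g)) :
    ∃ a ∈ supp f, ∃ b ∈ supp g, a * b = m := by
  obtain ⟨a, ha, b, hb, hab⟩ :=
    Set.mem_add.1 (support_mul_subset (show expo m ∈ (f * g).support from h))
  exact ⟨mono a, ha, mono b, hb, congrArg mono hab⟩

theorem supp_add_subset (f g : Hahn k G) : supp (f + g) ⊆ supp f ∪ supp g := by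
  intro m hm
  by_contra h
  rw [Set.mem_union, not_or] at h
  exact hm (by rw [coeff_add, coeff_eq_zero_of_notMem_supp h.1, coeff_eq_zero_of_notMem_supp h.2,
    add_zero])

theorem supp_neg (f : Hahn k G) : supp (-f) = supp f := by
  ext m
  rw [mem_supp, mem_supp, coeff_neg, neg_ne_zero]

theorem supp_single_subset (m : G) (r : k) : supp (single (expo m) r : Hahn k G) ⊆ {m} :=
  fun _ hn => congrArg mono (support_single_subset (show expo _ ∈ _ from hn))

theorem mem_supp_trunc {f : Hahn k G} {n m : G} : m ∈ supp (trunc f n) ↔ m ∈ supp f ∧ n < m := by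
  rw [mem_supp, mem_supp, coeff_trunc]
  split_ifs with h <;> simp [h]

theorem trunc_eq_self {f : Hahn k G} {n : G} (h : ∀ m ∈ supp f, n < m) : trunc f n = f :=
  truncLT_eq_self fun γ hγ => h (mono γ) hγ

theorem trunc_eq_zero {f : Hahn k G} {n : G} (h : ∀ m ∈ supp f, m ≤ n) : trunc f n = 0 :=
  truncLT_eq_zero fun γ hγ => h (mono γ) hγ

/-- The series with support in a submonoid of the group of monomials. -/
def supportedIn (k : Type*) [Field k] (L : Submonoid G) : Subring (Hahn k G) where
  carrier := {f | supp f ⊆ L}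
  mul_mem' hf hg := by
    intro m hm
    obtain ⟨a, ha, b, hb, rfl⟩ := exists_of_mem_supp_mul hm
    exact L.mul_mem (hf ha) (hg hb)
  one_mem' := by
    intro m hm
    rw [Set.mem_singleton_iff.1 (supp_single_subset (k := k) 1 1 hm)]
    exact L.one_mem
  add_mem' hf hg := (supp_add_subset _ _).trans (Set.union_subset hf hg)
  zero_mem' := fun m hm => absurd rfl hm
  neg_mem' := by
    intro f hf
    show supp (-f) ⊆ _
    rwa [supp_neg]

/-- The inclusion of the exponents of a subgroup. -/
def expoEmbedding (L : Subgroup G) : Expo L ↪o Expo G :=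
  ⟨⟨fun γ => expo (smono γ), fun _ _ h => congrArg expo (Subtype.ext h)⟩, Iff.rfl⟩

theorem exists_embDomain_expoEmbedding (L : Subgroup G) {f : Hahn k G} (h : supp f ⊆ L) :
    ∃ g : Hahn k L, embDomain (expoEmbedding L) g = f :=
  exists_embDomain_eq _ _ fun γ hγ => ⟨expo ⟨mono γ, h hγ⟩, rfl⟩

theorem supp_embDomain_expoEmbedding (L : Subgroup G) (g : Hahn k L) :
    supp (embDomain (expoEmbedding L) g) ⊆ L := by
  intro m hm
  by_contra h
  refine hm (embDomain_of_notMem_range ?_)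
  rintro ⟨γ, hγ⟩
  refine h ?_
  have e : (smono γ : G) = m := congrArg mono hγ
  exact e ▸ (mono γ).2

/-- The series supported in a subgroup are the image of a Hahn field under a ring embedding, and
such embeddings preserve inverses. -/
theorem supp_inv_subset (L : Subgroup G) {f : Hahn k G} (h : supp f ⊆ L) : supp f⁻¹ ⊆ L := by
  obtain ⟨g, rfl⟩ := exists_embDomain_expoEmbedding L h
  have e : (embDomain (expoEmbedding L) g)⁻¹ = embDomain (expoEmbedding L) g⁻¹ :=
    (map_inv₀ (embDomainRingHom
      { toFun := fun γ => expo (smono γ)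
        map_zero' := rfl
        map_add' := fun _ _ => rfl }
      (fun _ _ h => congrArg expo (Subtype.ext h))
      (fun _ _ => Iff.rfl) : Hahn k L →+* Hahn k G) g).symm
  rw [e]
  exact supp_embDomain_expoEmbedding L _

end Supp

namespace MonomialChain

/-! ### Convexity and unique factorization in the chain of monomial groups. -/

section Order

variable {M : Type*} [CommGroup M] [LinearOrder M] [IsOrderedMonoid M] (T : MonomialChain M)

theorem below_mono {i j : ℕ} (h : i ≤ j) : T.below i ≤ T.below j := by
  induction j, h using Nat.le_induction with
  | base => exact le_rfl
  | succ j _ ih => exact ih.trans (T.below_le_below_succ j)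

theorem below_zero : T.below 0 = ⊥ := by simp [below, prodBelow]

/-- The subgroups `M_0 ⋯ M_n` are convex. -/
theorem mem_below_of_le_of_le {j : ℕ} {a b x : M} (ha : a ∈ T.below j) (hb : b ∈ T.below j)
    (hax : a ≤ x) (hxb : x ≤ b) : x ∈ T.below j := by
  have key : ∀ n, x ∈ T.below (j + n) → x ∈ T.below j := by
    intro n
    induction n with
    | zero => exact id
    | succ n ih =>
      intro hx
      refine ih ?_
      rw [← add_assoc, T.below_succ, Subgroup.mem_sup] at hx
      obtain ⟨y, hy, z, hz, rfl⟩ := hx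
      have ha' := T.below_mono (Nat.le_add_right j n) ha
      have hb' := T.below_mono (Nat.le_add_right j n) hb
      -- A top factor `z ≠ 1` would push `y * z` below `a` or above `b`, since `z` or its inverse
      -- dominates `M_0 ⋯ M_{j+n-1}`.
      rcases lt_trichotomy z 1 with h | h | h
      · exfalso
        have h1 := T.below_lt ((T.sub _).inv_mem hz) (one_lt_inv'.2 h) _ le_rfl _
          ((T.below _).mul_mem ((T.below _).inv_mem ha') hy)
        rw [inv_mul_lt_iff_lt_mul, ← div_eq_mul_inv, lt_div_iff_mul_lt] at h1
        exact hax.not_gt h1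
      · rwa [h, mul_one]
      · exfalso
        have h1 := T.below_lt hz h _ le_rfl _
          ((T.below _).mul_mem ((T.below _).inv_mem hy) hb')
        rw [inv_mul_lt_iff_lt_mul] at h1
        exact hxb.not_gt h1
  obtain ⟨n, hn⟩ := T.exhaust x
  refine key (n + 1) (T.below_mono ?_ hn)
  omega

theorem eq_one_of_mem_sub_of_mem_below {n : ℕ} {a : M} (ha : a ∈ T.sub n) (hb : a ∈ T.below n) :
    a = 1 := by
  rcases lt_trichotomy a 1 with h | h | h
  · exact absurd (T.below_lt ((T.sub n).inv_mem ha) (one_lt_inv'.2 h) n le_rfl _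
      ((T.below n).inv_mem hb)) (lt_irrefl _)
  · exact h
  · exact absurd (T.below_lt ha h n le_rfl _ hb) (lt_irrefl _)

theorem mul_eq_mul_of_mem {n : ℕ} {a a' b b' : M} (ha : a ∈ T.sub n) (ha' : a' ∈ T.sub n)
    (hb : b ∈ T.below n) (hb' : b' ∈ T.below n) (h : b * a = b' * a') : b = b' ∧ a = a' := by
  have e : a / a' = b' / b := by rw [div_eq_div_iff_mul_eq_mul, mul_comm, h]
  have h1 := T.eq_one_of_mem_sub_of_mem_below ((T.sub n).div_mem ha ha')
    (e ▸ (T.below n).div_mem hb' hb)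
  have h2 : a = a' := div_eq_one.1 h1
  subst h2
  exact ⟨mul_right_cancel h, rfl⟩

end Order

/-! ### Supports in the levels of `k_*`, and the derivation on monomials. -/

section Field

variable {k : Type*} [Field k] {M : Type*} [CommGroup M] [LinearOrder M] [IsOrderedMonoid M]
  (T : MonomialChain M)

/-- Turns membership in a level of `k_*` into a support condition, so that passing between levels
becomes a matter of cosets of monomials. -/
theorem mem_range_toStar {n : ℕ} {f : T.kStar k} :
    (∃ g, T.toStar n g = f) ↔ supp (f : Hahn k M) ⊆ T.below n := by
  refine ⟨?_, fun h => ?_⟩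
  · rintro ⟨g, rfl⟩
    exact supp_embDomain_expoEmbedding (T.below n) g
  · obtain ⟨g, hg⟩ := exists_embDomain_expoEmbedding (T.below n) h
    exact ⟨g, Subtype.ext hg⟩

theorem exists_supp_subset_below (f : T.kStar k) : ∃ n, supp (f : Hahn k M) ⊆ T.below n := by
  obtain ⟨n, g, h⟩ := f.2
  exact ⟨n, T.mem_range_toStar.1 ⟨g, Subtype.ext h⟩⟩

theorem toStar_identify_coeff {n : ℕ} (x : HahnSeries (Expo (T.sub n)) (Hahn k (T.below n)))
    (a : T.sub n) (b : T.below n) :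
    (T.toStar (n + 1) (T.identify n x) : Hahn k M).coeff (expo ((b : M) * a))
      = (x.coeff (expo a)).coeff (expo b) :=
  (T.incl_coeff (n + 1) (T.identify n x) (T.split n (toLex (expo a, expo b)))).trans
    (glue_coeff (T.split n) (T.split_add n) x (expo a) (expo b))

theorem toStar_identify_single {n : ℕ} (a : T.sub n) :
    T.toStar (n + 1) (T.identify n (single (expo a) (1 : Hahn k (T.below n))))
      = T.monomial (a : M) := by
  refine Subtype.ext ?_
  ext γ
  by_cases h : mono γ ∈ T.below (n + 1)
  · rw [T.below_succ, Subgroup.mem_sup] at h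
    obtain ⟨b, hb, a', ha', hab⟩ := h
    have hγ : γ = expo (((⟨b, hb⟩ : T.below n) : M) * (⟨a', ha'⟩ : T.sub n)) :=
      congrArg expo hab.symm
    rw [hγ, toStar_identify_coeff]
    by_cases h1 : b * a' = a
    · have h2 := T.mul_eq_mul_of_mem ha' a.2 hb (T.below n).one_mem (h1.trans (one_mul _).symm)
      obtain ⟨rfl, rfl⟩ := h2
      have e1 : (expo (⟨1, hb⟩ : T.below n)) = 0 := rfl
      have e2 : (expo (((⟨1, hb⟩ : T.below n) : M) * (⟨a, ha'⟩ : T.sub n)) : Expo M)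
        = expo (a : M) := congrArg expo (one_mul _)
      rw [coeff_single_same, e1, e2]
      simp [monomial]
    · have h2 : (T.monomial (a : M) : T.kStar k).1.coeff (expo (b * a')) = 0 :=
        coeff_single_of_ne fun e => h1 (congrArg mono e)
      rw [h2]
      by_cases h3 : a' = a
      · have e1 : (⟨a', ha'⟩ : T.sub n) = a := Subtype.ext h3
        rw [e1, coeff_single_same, coeff_one, if_neg]
        intro e
        refine h1 ?_
        have : b = 1 := congrArg (fun γ => smono γ) e
        rw [this, h3, one_mul]
      · rw [coeff_single_of_ne, coeff_zero]
        exact fun e => h3 (congrArg (fun γ => smono γ) e)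
  · have h1 : (T.toStar (n + 1) (T.identify n (single (expo a) (1 : Hahn k (T.below n)))) :
        Hahn k M).coeff γ = 0 := T.incl_coeff_of_notMem _ _ _ h
    rw [h1]
    refine (coeff_single_of_ne ?_).symm
    rintro rfl
    exact h (T.sub_le_below_succ n a.2)

theorem toStar_step (n : ℕ) (f : Hahn k (T.below n)) :
    T.toStar (n + 1) (T.step n f) = T.toStar n f := Subtype.ext (T.incl_step n f)

theorem coe_const (a : k) : (T.const a : Hahn k M) = single (expo 1) a :=
  embDomain_single (f := expoEmbedding (T.below 0))

theorem coe_monomial (m : M) : ((T.monomial m : T.kStar k) : Hahn k M) = single (expo m) 1 := rfl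

theorem monomial_one : (T.monomial 1 : T.kStar k) = 1 := rfl

theorem monomial_mul (a b : M) : (T.monomial (a * b) : T.kStar k) = T.monomial a * T.monomial b := by
  refine Subtype.ext ?_
  refine Eq.trans ?_ (single_mul_single (a := expo a) (b := expo b) (r := (1 : k)) (s := 1)).symm
  rw [mul_one]
  rfl

theorem monomial_inv (a : M) : (T.monomial a⁻¹ : T.kStar k) = (T.monomial a)⁻¹ := by
  refine eq_inv_of_mul_eq_one_left ?_
  rw [← monomial_mul, inv_mul_cancel, monomial_one]

theorem supp_monomial_mul (a : M) (f : T.kStar k) :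
    supp ((T.monomial a * f : T.kStar k) : Hahn k M) = {m | a⁻¹ * m ∈ supp (f : Hahn k M)} := by
  have key : ∀ (a : M) (f : T.kStar k) (m), m ∈ supp ((T.monomial a * f : T.kStar k) : Hahn k M) →
      a⁻¹ * m ∈ supp (f : Hahn k M) := by
    intro a f m hm
    obtain ⟨x, hx, y, hy, rfl⟩ := exists_of_mem_supp_mul hm
    have hx : x = a := supp_single_subset _ _ hx
    rwa [hx, inv_mul_cancel_left]
  ext m
  refine ⟨key a f m, fun h => ?_⟩
  have := key a⁻¹ (T.monomial a * f) (a⁻¹ * m)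
  rw [← mul_assoc, ← monomial_mul, inv_mul_cancel, monomial_one, one_mul, inv_inv,
    mul_inv_cancel_left] at this
  exact this h

variable [Differential k] (c : ∀ n, Additive (T.sub n) →+ Hahn k (T.below n))

theorem deriv_add (f g : T.kStar k) : T.deriv c (f + g) = T.deriv c f + T.deriv c g :=
  map_add (T.differential c).deriv f g

theorem deriv_neg (f : T.kStar k) : T.deriv c (-f) = -T.deriv c f :=
  map_neg (T.differential c).deriv f

theorem deriv_zero : T.deriv c (0 : T.kStar k) = 0 :=
  map_zero (T.differential c).deriv

theorem deriv_mul (f g : T.kStar k) : T.deriv c (f * g) = f * T.deriv c g + g * T.deriv c f :=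
  differential_mul (T.differential c) f g

theorem deriv_const (a : k) : T.deriv c (T.const a) = T.const (Differential.deriv a) := by
  refine (T.deriv_toStar c 0 (C a)).trans (congrArg (T.toStar 0) ?_)
  ext γ
  rw [derivLevel, hahnDeriv_coeff]
  by_cases h : γ = 0
  · subst h; simp
  · simp [h]

/-- The map from the exponents of `M_n` to `k_{n-1}` given by `c n`. -/
def expoMap (n : ℕ) : Expo (T.sub n) →+ Hahn k (T.below n) where
  toFun γ := c n (OrderDual.ofDual γ)
  map_zero' := map_zero (c n)
  map_add' γ η := map_add (c n) (OrderDual.ofDual γ) (OrderDual.ofDual η)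

theorem deriv_toStar_identify {n : ℕ} (x : HahnSeries (Expo (T.sub n)) (Hahn k (T.below n))) :
    T.deriv c (T.toStar (n + 1) (T.identify n x))
      = T.toStar (n + 1) (T.identify n
          ((hahnDeriv (T.derivLevel c n) (T.expoMap c n)).deriv x)) := by
  rw [deriv_toStar]
  refine congrArg (T.toStar (n + 1)) ?_
  change T.identify n ((hahnDeriv (T.derivLevel c n) _).deriv ((T.identify n).symm
    (T.identify n x))) = _
  rw [RingEquiv.symm_apply_apply]
  rfl

theorem deriv_monomial {n : ℕ} (a : T.sub n) :
    T.deriv c (T.monomial (a : M)) = T.cStar c n a * T.monomial (a : M) := by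
  rw [← toStar_identify_single, deriv_toStar_identify, cStar,
    ← T.toStar_step n (c n (Additive.ofMul a)), ← map_mul]
  refine congrArg (T.toStar (n + 1)) ?_
  rw [step, RingHom.comp_apply]
  refine Eq.trans ?_ (map_mul (T.identify n) _ _)
  refine congrArg (T.identify n) ?_
  ext1
  funext γ
  rw [hahnDeriv_coeff, C_mul_eq_smul, coeff_smul, smul_eq_mul]
  by_cases h : γ = expo a
  · rw [h, coeff_single_same, one_mul, mul_one]
    rw [differential_one, zero_add]
    rfl
  · rw [coeff_single_of_ne h]
    simp

/-- On `k_n`, the derivation does not create new components in `M_n`. -/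
theorem exists_mem_supp_of_mem_supp_deriv {j : ℕ} {f : T.kStar k}
    (hf : supp (f : Hahn k M) ⊆ T.below (j + 1)) {m : M}
    (hm : m ∈ supp (T.deriv c f : Hahn k M)) :
    ∃ m₀ ∈ supp (f : Hahn k M), m / m₀ ∈ T.below j := by
  obtain ⟨g, rfl⟩ := T.mem_range_toStar.2 hf
  obtain ⟨x, rfl⟩ := (T.identify (k := k) j).surjective g
  rw [deriv_toStar_identify] at hm
  have hmb := T.mem_range_toStar.1 ⟨_, rfl⟩ hm
  rw [SetLike.mem_coe, T.below_succ, Subgroup.mem_sup] at hmb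
  obtain ⟨b, hb, a, ha, rfl⟩ := hmb
  rw [mem_supp] at hm
  have e := T.toStar_identify_coeff
    ((hahnDeriv (T.derivLevel c j) (T.expoMap c j)).deriv x) ⟨a, ha⟩ ⟨b, hb⟩
  rw [show ((⟨b, hb⟩ : T.below j) : M) * (⟨a, ha⟩ : T.sub j) = b * a from rfl] at e
  rw [e, hahnDeriv_coeff] at hm
  -- The coefficient of `a` in the derivative is `x_a' + x_a c_j(a)`, which vanishes with `x_a`.
  have hx : x.coeff (expo ⟨a, ha⟩) ≠ 0 := by
    intro h0
    rw [h0, map_zero, zero_mul, add_zero] at hm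
    exact hm rfl
  have hx' : (supp (x.coeff (expo ⟨a, ha⟩))).Nonempty := by
    rw [Set.nonempty_iff_ne_empty]
    exact fun h => hx (supp_eq_empty.1 h)
  obtain ⟨b₀, hb₀⟩ := hx'
  refine ⟨(b₀ : M) * a, ?_, ?_⟩
  · rw [mem_supp]
    have e := T.toStar_identify_coeff x ⟨a, ha⟩ b₀
    rw [show (b₀ : M) * (⟨a, ha⟩ : T.sub j) = b₀ * a from rfl] at e
    rw [e]
    exact hb₀
  · rw [mul_div_mul_right_eq_div]
    exact (T.below j).div_mem hb b₀.2

end Field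

end MonomialChain

namespace MonomialChain

/-! ### Monomials whose factors lie in prescribed submonoids. -/

section Levels

variable {M : Type*} [CommGroup M] [LinearOrder M] [IsOrderedMonoid M] (T : MonomialChain M)
  (P : ∀ n, Submonoid (T.sub n))

/-- The products `m_0 ⋯ m_{n-1}` with `m_i ∈ P i`. -/
def levelMonoid : ℕ → Submonoid M
  | 0 => ⊥
  | n + 1 => levelMonoid n ⊔ (P n).map (T.sub n).subtype

/-- The products `m_0 ⋯ m_n`, for any `n`, with `m_i ∈ P i`. -/
def unionMonoid : Submonoid M := ⨆ n, T.levelMonoid P n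

theorem mem_levelMonoid_succ {n : ℕ} {x : M} :
    x ∈ T.levelMonoid P (n + 1) ↔ ∃ b ∈ T.levelMonoid P n, ∃ a ∈ P n, b * (a : M) = x := by
  rw [levelMonoid, Submonoid.mem_sup]
  simp only [Submonoid.mem_map]
  constructor
  · rintro ⟨b, hb, _, ⟨a, ha, rfl⟩, h⟩
    exact ⟨b, hb, a, ha, h⟩
  · rintro ⟨b, hb, a, ha, h⟩
    exact ⟨b, hb, _, ⟨a, ha, rfl⟩, h⟩

theorem levelMonoid_mono : Monotone (T.levelMonoid P) :=
  monotone_nat_of_le_succ fun _ => le_sup_left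

theorem levelMonoid_le_below {n : ℕ} {x : M} (hx : x ∈ T.levelMonoid P n) : x ∈ T.below n := by
  induction n generalizing x with
  | zero =>
    rw [Submonoid.mem_bot.1 hx]
    exact (T.below 0).one_mem
  | succ n ih =>
    obtain ⟨b, hb, a, -, rfl⟩ := (T.mem_levelMonoid_succ P).1 hx
    exact (T.below _).mul_mem (T.below_le_below_succ n (ih hb)) (T.sub_le_below_succ n a.2)

theorem mem_unionMonoid {x : M} : x ∈ T.unionMonoid P ↔ ∃ n, x ∈ T.levelMonoid P n :=
  Submonoid.mem_iSup_of_directed (T.levelMonoid_mono P).directed_le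

/-- The factors from `M_n` on are trivial because `M_N` meets `M_0 ⋯ M_{N-1}` only in `1`; they are
stripped from the top. -/
theorem mem_levelMonoid_of_mem_below {n : ℕ} {x : M} (hx : x ∈ T.unionMonoid P)
    (hn : x ∈ T.below n) : x ∈ T.levelMonoid P n := by
  obtain ⟨N, hN⟩ := (T.mem_unionMonoid P).1 hx
  induction N with
  | zero => exact T.levelMonoid_mono P (Nat.zero_le n) hN
  | succ N ih =>
    rcases le_or_gt (N + 1) n with h | h
    · exact T.levelMonoid_mono P h hN
    · obtain ⟨b, hb, a, -, rfl⟩ := (T.mem_levelMonoid_succ P).1 hN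
      have h1 := T.levelMonoid_le_below P hb
      have h2 := (T.below N).mul_mem ((T.below N).inv_mem h1) (T.below_mono (Nat.le_of_lt_succ h) hn)
      rw [inv_mul_cancel_left] at h2
      have h3 := T.eq_one_of_mem_sub_of_mem_below a.2 h2
      rw [h3, mul_one] at ih ⊢
      exact ih hb

theorem prod_mem_below (m : ∀ i, T.sub i) (n : ℕ) : ∏ i ∈ range n, (m i : M) ∈ T.below n :=
  (T.below n).prod_mem fun i hi =>
    T.below_mono (Finset.mem_range.1 hi) (T.sub_le_below_succ i (m i).2)

theorem prod_mem_levelMonoid_iff {m : ∀ i, T.sub i} {n : ℕ} :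
    ∏ i ∈ range n, (m i : M) ∈ T.levelMonoid P n ↔ ∀ i < n, m i ∈ P i := by
  induction n with
  | zero => simp [levelMonoid]
  | succ n ih =>
    rw [prod_range_succ, mem_levelMonoid_succ]
    constructor
    · rintro ⟨b, hb, a, ha, h⟩
      obtain ⟨rfl, h2⟩ := T.mul_eq_mul_of_mem a.2 (m n).2 (T.levelMonoid_le_below P hb)
        (T.prod_mem_below m n) h
      intro i hi
      rcases Nat.lt_succ_iff_lt_or_eq.1 hi with h | rfl
      · exact ih.1 hb i h
      · rwa [← Subtype.ext h2]
    · intro h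
      exact ⟨_, ih.2 fun i hi => h i (hi.trans n.lt_succ_self), m n, h n n.lt_succ_self, rfl⟩

theorem exists_prod_eq {n : ℕ} {x : M} (hx : x ∈ T.below n) :
    ∃ m : ∀ i, T.sub i, ∏ i ∈ range n, (m i : M) = x := by
  induction n generalizing x with
  | zero =>
    rw [below_zero, Subgroup.mem_bot] at hx
    exact ⟨fun _ => 1, by simp [hx]⟩
  | succ n ih =>
    rw [below_succ, Subgroup.mem_sup] at hx
    obtain ⟨b, hb, a, ha, rfl⟩ := hx
    obtain ⟨m, rfl⟩ := ih hb
    refine ⟨Function.update m n ⟨a, ha⟩, ?_⟩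
    rw [prod_range_succ, Function.update_self]
    congr 1
    refine prod_congr rfl fun i hi => ?_
    rw [Function.update_of_ne (Finset.mem_range.1 hi).ne]

theorem inv_mem_unionMonoid (hP : ∀ n, ∀ a ∈ P n, a⁻¹ ∈ P n) {x : M} (hx : x ∈ T.unionMonoid P) :
    x⁻¹ ∈ T.unionMonoid P := by
  obtain ⟨n, hn⟩ := (T.mem_unionMonoid P).1 hx
  refine (T.mem_unionMonoid P).2 ⟨n, ?_⟩
  clear hx
  induction n generalizing x with
  | zero =>
    rw [Submonoid.mem_bot.1 hn, inv_one]
    exact one_mem _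
  | succ n ih =>
    obtain ⟨b, hb, a, ha, rfl⟩ := (T.mem_levelMonoid_succ P).1 hn
    exact (T.mem_levelMonoid_succ P).2 ⟨b⁻¹, ih hb, a⁻¹, hP n a ha, (mul_inv _ _).symm⟩

end Levels

/-! ### Cutting series along cosets, and lowering the level of antiderivatives. -/

section Decomposition

variable {k : Type*} [Field k] {M : Type*} [CommGroup M] [LinearOrder M] [IsOrderedMonoid M]
  (T : MonomialChain M)

/-- If some monomial of the support is not in the upward closed set `U`, there is a largest one, and
truncating there keeps exactly the terms in `U`; otherwise `f` itself serves. -/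
theorem exists_restrict {V : Set (T.kStar k)} (hV : T.TruncationClosed V) {f : T.kStar k}
    (hf : f ∈ V) (U : M → Prop) (hU : ∀ m m', U m → m ≤ m' → U m') :
    ∃ F ∈ V, (∀ m, U m → (F : Hahn k M).coeff (expo m) = (f : Hahn k M).coeff (expo m)) ∧
      ∀ m, ¬U m → (F : Hahn k M).coeff (expo m) = 0 := by
  by_cases h : ∃ m ∈ supp (f : Hahn k M), ¬U m
  · have hne : ((f : Hahn k M).support ∩ {γ | ¬U (mono γ)}).Nonempty :=
      h.imp fun m hm => ⟨hm.1, hm.2⟩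
    have hwf : ((f : Hahn k M).support ∩ {γ | ¬U (mono γ)}).IsWF :=
      (f : Hahn k M).isWF_support.mono Set.inter_subset_left
    obtain ⟨F, hF, e⟩ := hV f hf (mono (hwf.min hne))
    refine ⟨F, hF, fun m hm => ?_, fun m hm => ?_⟩
    · rw [e, coeff_trunc, if_pos]
      by_contra hle
      exact (hwf.min_mem hne).2 (hU _ _ hm (not_lt.1 hle))
    · rw [e, coeff_trunc]
      split_ifs with hlt
      · by_contra h0
        exact hwf.not_lt_min hne (show expo m ∈ _ from ⟨h0, hm⟩) hlt
      · rfl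
  · push Not at h
    refine ⟨f, hf, fun m _ => rfl, fun m hm => ?_⟩
    by_contra h0
    exact hm (h m h0)

/-- A series is the sum of its parts above, in, and below the coset of `n` modulo
`M_0 ⋯ M_{j-1}`. -/
theorem exists_decomposition {V : AddSubgroup (T.kStar k)}
    (hV : T.TruncationClosed (V : Set (T.kStar k))) {f : T.kStar k} (hf : f ∈ V) (n : M) (j : ℕ) :
    ∃ F ∈ V, ∃ G ∈ V, ∃ H ∈ V, f = F + G + H ∧
      (∀ m ∈ supp (F : Hahn k M), m ∈ supp (f : Hahn k M) ∧ ∀ b ∈ T.below j, n * b < m) ∧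
      (∀ m ∈ supp (G : Hahn k M), m ∈ supp (f : Hahn k M) ∧ m / n ∈ T.below j) ∧
      (∀ m ∈ supp (H : Hahn k M), m ∈ supp (f : Hahn k M) ∧ ∀ b ∈ T.below j, m < n * b) := by
  obtain ⟨F, hF, hF1, hF2⟩ := T.exists_restrict hV hf (fun m => ∀ b ∈ T.below j, n * b < m)
    (fun m m' h hm b hb => (h b hb).trans_le hm)
  obtain ⟨E, hE, hE1, hE2⟩ := T.exists_restrict hV hf (fun m => ∃ b ∈ T.below j, n * b ≤ m)
    (fun m m' ⟨b, hb, h⟩ hm => ⟨b, hb, h.trans hm⟩)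
  refine ⟨F, hF, E - F, V.sub_mem hE hF, f - E, V.sub_mem hf hE, by abel, ?_, ?_, ?_⟩
  · intro m hm
    have h := not_imp_comm.1 (hF2 m) hm
    exact ⟨by rwa [mem_supp, ← hF1 m h], h⟩
  · intro m hm
    rw [mem_supp] at hm
    have h1 : ∃ b ∈ T.below j, n * b ≤ m := by
      by_contra h
      refine hm ?_
      rw [Subfield.coe_sub, coeff_sub, hE2 m h, hF2 m, sub_zero]
      exact fun h' => h ⟨1, one_mem _, (h' 1 (one_mem _)).le⟩
    have h2 : ¬∀ b ∈ T.below j, n * b < m := by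
      intro h
      refine hm ?_
      rw [Subfield.coe_sub, coeff_sub, hE1 m h1, hF1 m h, sub_self]
    rw [Subfield.coe_sub, coeff_sub, hE1 m h1, hF2 m h2, sub_zero] at hm
    refine ⟨hm, ?_⟩
    push Not at h2
    obtain ⟨b, hb, h1⟩ := h1
    obtain ⟨b', hb', h2⟩ := h2
    exact T.mem_below_of_le_of_le hb hb' (le_div_iff_mul_le'.2 h1) (div_le_iff_le_mul'.2 h2)
  · intro m hm
    rw [mem_supp] at hm
    have h1 : ¬∃ b ∈ T.below j, n * b ≤ m := by
      intro h
      refine hm ?_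
      rw [Subfield.coe_sub, coeff_sub, hE1 m h, sub_self]
    rw [Subfield.coe_sub, coeff_sub, hE2 m h1, sub_zero] at hm
    push Not at h1
    exact ⟨hm, h1⟩

theorem eq_const_mul_monomial {f : T.kStar k} {μ : M} (hf : ∀ m ∈ supp (f : Hahn k M), m = μ) :
    f = T.const ((f : Hahn k M).coeff (expo μ)) * T.monomial μ := by
  refine Subtype.ext ?_
  rw [Subfield.coe_mul, coe_const, coe_monomial]
  have e : (single (expo (1 : M)) ((f : Hahn k M).coeff (expo μ)) * single (expo μ) (1 : k) :
      Hahn k M) = single (expo μ) ((f : Hahn k M).coeff (expo μ)) := by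
    refine single_mul_single.trans ?_
    rw [mul_one, show expo (1 : M) = 0 from rfl, zero_add]
  rw [e]
  ext γ
  by_cases h : γ = expo μ
  · rw [h, coeff_single_same]
  · rw [coeff_single_of_ne h]
    by_contra h0
    exact h (congrArg expo (hf (mono γ) h0))

variable [Differential k] (c : ∀ n, Additive (T.sub n) →+ Hahn k (T.below n))

/-- An antiderivative of an element of `k_{r-1}` may be chosen in `k_{r-1}`. -/
theorem exists_integral_in_below {V : AddSubgroup (T.kStar k)}
    (hV : T.TruncationClosed (V : Set (T.kStar k))) {l g : T.kStar k} (hl : l ∈ V)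
    (hg : T.deriv c l = g) {r : ℕ} (hr : supp (g : Hahn k M) ⊆ T.below r) :
    ∃ l' ∈ V, supp (l' : Hahn k M) ⊆ T.below r ∧ T.deriv c l' = g := by
  have key : ∀ s, ∀ l ∈ V, T.deriv c l = g → supp (l : Hahn k M) ⊆ T.below (r + s) →
      ∃ l' ∈ V, supp (l' : Hahn k M) ⊆ T.below r ∧ T.deriv c l' = g := by
    intro s
    induction s with
    | zero => exact fun l hl h1 h2 => ⟨l, hl, h2, h1⟩
    | succ s ih =>
      intro l hl h1 h2
      obtain ⟨F, hF, G, hG, H, hH, e, hF', hG', hH'⟩ :=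
        T.exists_decomposition hV hl 1 (r + s)
      -- Only the part `G` in the coset of `1` is kept. The derivation respects cosets of `M_0 ⋯
      -- M_{r+s-1}` on this level, so the derivatives of the other parts do not meet that coset,
      -- while `g` lives inside it.
      refine ih G hG ?_ fun m hm => by simpa using (hG' m hm).2
      have hd : T.deriv c l = T.deriv c F + T.deriv c G + T.deriv c H := by
        rw [e, deriv_add, deriv_add]
      refine Subtype.ext ?_
      ext γ
      obtain ⟨m, rfl⟩ : ∃ m : M, expo m = γ := ⟨mono γ, rfl⟩
      by_cases hm : m ∈ T.below (r + s)
      · have hF0 : (T.deriv c F : Hahn k M).coeff (expo m) = 0 := by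
          by_contra h0
          obtain ⟨m₀, hm₀, hb⟩ := T.exists_mem_supp_of_mem_supp_deriv c
            (fun x hx => h2 (hF' x hx).1) h0
          have := (hF' m₀ hm₀).2 m₀ (by simpa using (T.below _).mul_mem ((T.below _).inv_mem hb) hm)
          rw [one_mul] at this
          exact lt_irrefl _ this
        have hH0 : (T.deriv c H : Hahn k M).coeff (expo m) = 0 := by
          by_contra h0
          obtain ⟨m₀, hm₀, hb⟩ := T.exists_mem_supp_of_mem_supp_deriv c
            (fun x hx => h2 (hH' x hx).1) h0
          have := (hH' m₀ hm₀).2 m₀ (by simpa using (T.below _).mul_mem ((T.below _).inv_mem hb) hm)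
          rw [one_mul] at this
          exact lt_irrefl _ this
        rw [← h1, hd, Subfield.coe_add, Subfield.coe_add, coeff_add, coeff_add, hF0, hH0, zero_add,
          add_zero]
      · have hg0 : (g : Hahn k M).coeff (expo m) = 0 := by
          by_contra h0
          exact hm (T.below_mono (Nat.le_add_right r s) (hr h0))
        rw [hg0]
        by_contra h0
        obtain ⟨m₀, hm₀, hb⟩ := T.exists_mem_supp_of_mem_supp_deriv c
          (fun x hx => h2 (hG' x hx).1) h0
        refine hm ?_
        have h3 := (T.below _).mul_mem hb (hG' m₀ hm₀).2
        rwa [div_one, div_mul_cancel] at h3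
  obtain ⟨n, hn⟩ := T.exists_supp_subset_below l
  exact key n l hl hg fun m hm => T.below_mono (Nat.le_add_left n r) (hn hm)

end Decomposition

/-! ### The core of a subring, and its closure properties. -/

section Main

variable {k : Type*} [Field k] {M : Type*} [CommGroup M] [LinearOrder M] [IsOrderedMonoid M]
  (T : MonomialChain M)

/-- The elements of a subring `A` of `k_*` that have all their truncations in `A` and their support
in `L`. -/
def core (A : Subring (T.kStar k)) (L : Submonoid M) : Subring (T.kStar k) :=
  (truncationCore (A.map (T.kStar k).subtype)
    (fun n => truncLT_single_mem _ (A.map (T.kStar k).subtype).one_mem n) ⊓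
      supportedIn k L).comap (T.kStar k).subtype

theorem mem_core {A : Subring (T.kStar k)} {L : Submonoid M} {f : T.kStar k} :
    f ∈ T.core A L ↔ f ∈ A ∧ (∀ n, ∃ g ∈ A, (g : Hahn k M) = trunc (f : Hahn k M) n) ∧
      supp (f : Hahn k M) ⊆ L := by
  constructor
  · rintro ⟨⟨⟨g, hg, e⟩, h2⟩, h3⟩
    refine ⟨?_, fun n => h2 (expo n), h3⟩
    rwa [← Subtype.ext e]
  · rintro ⟨h1, h2, h3⟩
    exact ⟨⟨⟨f, h1, rfl⟩, fun γ => h2 (mono γ)⟩, h3⟩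

theorem core_truncationClosed (A : Subring (T.kStar k)) (L : Submonoid M) :
    T.TruncationClosed (T.core A L : Set (T.kStar k)) := by
  intro f hf n
  obtain ⟨h1, h2, h3⟩ := T.mem_core.1 hf
  obtain ⟨g, hg, e⟩ := h2 n
  refine ⟨g, T.mem_core.2 ⟨hg, fun m => ?_, fun m hm => ?_⟩, e⟩
  · rw [e, trunc, trunc, truncLT_truncLT]
    exact h2 (mono (min (expo m) (expo n)))
  · rw [e] at hm
    exact h3 (mem_supp_trunc.1 hm).1

theorem const_mem_core {A : Subring (T.kStar k)} (L : Submonoid M) (hA : ∀ a, T.const a ∈ A)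
    (a : k) : T.const a ∈ T.core A L := by
  refine T.mem_core.2 ⟨hA a, fun n => ?_, ?_⟩
  · have h := truncLT_single_mem (A.map (T.kStar k).subtype) (γ := expo (1 : M)) (r := a)
      ⟨_, hA a, T.coe_const a⟩ (expo n)
    rw [coe_const]
    exact h
  · rw [coe_const]
    intro m hm
    rw [Set.mem_singleton_iff.1 (supp_single_subset _ _ hm)]
    exact L.one_mem

theorem inv_mem_core (A : Subfield (T.kStar k)) {L : Submonoid M} (hL : ∀ m ∈ L, m⁻¹ ∈ L)
    {f : T.kStar k} (hf : f ∈ T.core A.toSubring L) : f⁻¹ ∈ T.core A.toSubring L := by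
  obtain ⟨h1, h2, h3⟩ := T.mem_core.1 hf
  refine T.mem_core.2 ⟨A.inv_mem h1, fun n => ?_, ?_⟩
  · exact truncLT_inv_mem (A.map (T.kStar k).subtype) f ⟨f, h1, rfl⟩ (fun γ => h2 (mono γ)) (expo n)
  · exact supp_inv_subset { L with inv_mem' := fun h => hL _ h } h3

/-- Passing from `S` to its additive span makes antiderivatives additive without losing truncation
closedness, as `admissible` and `exists_integral_in_below` require. -/
theorem truncationClosed_closure {S : Set (T.kStar k)} (hS : T.TruncationClosed S) :
    T.TruncationClosed (AddSubgroup.closure S : Set (T.kStar k)) := by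
  intro f hf n
  induction hf using AddSubgroup.closure_induction with
  | mem f hf =>
    obtain ⟨g, hg, e⟩ := hS f hf n
    exact ⟨g, AddSubgroup.subset_closure hg, e⟩
  | zero => exact ⟨0, zero_mem _, (map_zero (truncLT (expo n))).symm⟩
  | add f g _ _ hf hg =>
    obtain ⟨f', hf', e⟩ := hf
    obtain ⟨g', hg', e'⟩ := hg
    refine ⟨f' + g', add_mem hf' hg', ?_⟩
    rw [Subfield.coe_add, Subfield.coe_add, e, e', trunc, trunc, trunc, HahnSeries.truncLT_add]
  | neg f _ hf =>
    obtain ⟨f', hf', e⟩ := hf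
    refine ⟨-f', neg_mem hf', ?_⟩
    rw [Subfield.coe_neg, Subfield.coe_neg, e, trunc, trunc, truncLT_neg]

variable (c : ∀ n, Additive (T.sub n) →+ Hahn k (T.below n))

theorem cStar_one (n : ℕ) : T.cStar c n 1 = 0 := by
  rw [cStar, ofMul_one, map_zero, map_zero]

theorem cStar_mul (n : ℕ) (a b : T.sub n) :
    T.cStar c n (a * b) = T.cStar c n a + T.cStar c n b := by
  rw [cStar, ofMul_mul, map_add, map_add]; rfl

theorem cStar_inv (n : ℕ) (a : T.sub n) : T.cStar c n a⁻¹ = -T.cStar c n a := by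
  rw [cStar, ofMul_inv, map_neg, map_neg]; rfl

theorem supp_cStar_subset (n : ℕ) (a : T.sub n) :
    supp (T.cStar c n a : Hahn k M) ⊆ T.below n :=
  T.mem_range_toStar.1 ⟨_, rfl⟩

variable [Differential k]

/-- For `n ≥ 1`, the monomials of `M_n` that lie in `A` and whose logarithmic derivative has an
antiderivative in `V`; for `n = 0`, all monomials of `M_0`. -/
def admissible (A : Subring (T.kStar k)) (V : AddSubgroup (T.kStar k)) (n : ℕ) :
    Submonoid (T.sub n) where
  carrier := {a | n = 0 ∨ T.monomial (a : M) ∈ A ∧ T.HasIntegralIn c V (T.cStar c n a)}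
  one_mem' := Or.inr ⟨A.one_mem, 0, V.zero_mem, by rw [deriv_zero, cStar_one]⟩
  mul_mem' := by
    rintro a b (h | ⟨h1, l, hl, h2⟩) h'
    · exact Or.inl h
    · rcases h' with h' | ⟨h1', l', hl', h2'⟩
      · exact Or.inl h'
      · refine Or.inr ⟨?_, l + l', V.add_mem hl hl', ?_⟩
        · rw [Subgroup.coe_mul, monomial_mul]
          exact A.mul_mem h1 h1'
        · rw [deriv_add, h2, h2', cStar_mul]

variable (A : Subring (T.kStar k))

/-- On a coset of `M_0 ⋯ M_j`, the map `f ↦ f' - d f`, where `d` is the logarithmic derivative of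
a monomial in the coset, does not create new components in `M_j`. -/
theorem exists_mem_supp_of_mem_supp_deriv_sub {μ : M} {d : T.kStar k}
    (hd : T.deriv c (T.monomial μ) = d * T.monomial μ) {j : ℕ} {f : T.kStar k}
    (hf : ∀ m ∈ supp (f : Hahn k M), m / μ ∈ T.below (j + 1)) {m : M}
    (hm : m ∈ supp ((T.deriv c f - d * f : T.kStar k) : Hahn k M)) :
    ∃ m₀ ∈ supp (f : Hahn k M), m / m₀ ∈ T.below j := by
  obtain ⟨g, rfl⟩ : ∃ g, T.monomial μ * g = f :=
    ⟨T.monomial μ⁻¹ * f, by rw [← mul_assoc, ← monomial_mul, mul_inv_cancel, monomial_one, one_mul]⟩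
  have e : T.deriv c (T.monomial μ * g) - d * (T.monomial μ * g)
      = T.monomial μ * T.deriv c g := by
    rw [deriv_mul, hd]; ring
  rw [e, supp_monomial_mul] at hm
  rw [supp_monomial_mul] at hf ⊢
  obtain ⟨m₀, h1, h2⟩ := T.exists_mem_supp_of_mem_supp_deriv c
    (f := g) (j := j) (m := μ⁻¹ * m) (fun x hx => by
      have := hf (μ * x) (by simpa using hx)
      rwa [mul_div_cancel_left] at this) hm
  refine ⟨μ * m₀, by simpa using h1, ?_⟩
  rwa [← div_div, div_eq_inv_mul m μ]

/-- Induction on the size `j` of the coset, with `r` and the logarithmic derivatives of level `r`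
fixed. For `j = 0` only one term is left; in the step, a cut at `n` affects only the part of `f` in
the coset of `n` modulo `M_0 ⋯ M_{j-1}`. -/
theorem deriv_mem_core_of_coset {P : ∀ n, Submonoid (T.sub n)} (hconst : ∀ a, T.const a ∈ A)
    (hderiv : ∀ f ∈ A, T.deriv c f ∈ A) {r : ℕ}
    (hlog : ∀ μ ∈ T.levelMonoid P r, ∃ d ∈ T.core A (T.unionMonoid P),
      T.deriv c (T.monomial μ) = d * T.monomial μ) {j : ℕ} (hj : j ≤ r) :
    ∀ f ∈ T.core A (T.unionMonoid P), ∀ μ ∈ T.levelMonoid P r,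
      (∀ m ∈ supp (f : Hahn k M), m / μ ∈ T.below j) →
        T.deriv c f ∈ T.core A (T.unionMonoid P) := by
  set D := T.core A (T.unionMonoid P) with hD
  induction j with
  | zero =>
    intro f hf μ hμ hfμ
    obtain ⟨d, hd, hdμ⟩ := hlog μ hμ
    have h1 := T.eq_const_mul_monomial (f := f) (μ := μ) fun m hm => by
      have := hfμ m hm
      rwa [below_zero, Subgroup.mem_bot, div_eq_one] at this
    set a := (f : Hahn k M).coeff (expo μ)
    by_cases ha : a = 0
    · rw [h1, ha, map_zero, zero_mul, deriv_zero]
      exact D.zero_mem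
    · have e : T.deriv c f = d * f + T.const (Differential.deriv a / a) * f := by
        rw [h1, deriv_mul, hdμ, deriv_const, div_eq_mul_inv, map_mul, map_inv₀]
        have : T.const a ≠ 0 := (map_ne_zero _).2 ha
        field_simp
      rw [e]
      exact D.add_mem (D.mul_mem hd hf) (D.mul_mem (T.const_mem_core _ hconst _) hf)
  | succ j ih =>
    intro f hf μ hμ hfμ
    obtain ⟨d, hd, hdμ⟩ := hlog μ hμ
    suffices hy : T.deriv c f - d * f ∈ D by
      have := D.add_mem hy (D.mul_mem hd hf)
      rwa [sub_add_cancel] at this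
    have hDA : ∀ g ∈ D, g ∈ A := fun g hg => (T.mem_core.1 hg).1
    have hyA : ∀ g ∈ D, T.deriv c g - d * g ∈ A := fun g hg =>
      A.sub_mem (hderiv g (hDA g hg)) (hDA _ (D.mul_mem hd hg))
    -- The operator `g ↦ g' - d g`, applied to the parts of `f` above and below the coset of `n`,
    -- stays strictly above and below `n`. Thus the truncation at `n` and the coefficient of `n` are
    -- controlled by the middle part.
    have key : ∀ n : M, ∃ yF ∈ A, ∃ yG ∈ D, ∃ yH : T.kStar k,
        T.deriv c f - d * f = yF + yG + yH ∧ (∀ m ∈ supp (yF : Hahn k M), n < m) ∧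
        ∀ m ∈ supp (yH : Hahn k M), m < n := by
      intro n
      obtain ⟨F, hF, G, hG, H, hH, e, hF', hG', hH'⟩ := T.exists_decomposition
        (V := D.toAddSubgroup) (T.core_truncationClosed A _) hf n j
      refine ⟨T.deriv c F - d * F, hyA F hF, T.deriv c G - d * G, D.sub_mem ?_ (D.mul_mem hd hG),
        T.deriv c H - d * H, ?_, ?_, ?_⟩
      · by_cases h0 : ∃ μ', μ' ∈ supp (G : Hahn k M)
        · obtain ⟨μ', hμ'⟩ := h0
          -- Any monomial of `G` represents its coset. It lies in `unionMonoid P` because `G` is in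
          -- the core, and in `M_0 ⋯ M_{r-1}` because `μ` does and `j < r`.
          refine ih (Nat.le_of_succ_le hj) G hG μ' ?_ fun m hm => ?_
          · refine T.mem_levelMonoid_of_mem_below P ((T.mem_core.1 hG).2.2 hμ') ?_
            have := (T.below r).mul_mem (T.below_mono hj (hfμ μ' (hG' μ' hμ').1))
              (T.levelMonoid_le_below P hμ)
            rwa [div_mul_cancel] at this
          · rw [← div_div_div_cancel_right m μ' n]
            exact (T.below j).div_mem (hG' m hm).2 (hG' μ' hμ').2
        · have h1 : G = 0 := Subtype.ext
            (supp_eq_empty.1 (Set.eq_empty_iff_forall_notMem.2 fun m hm => h0 ⟨m, hm⟩))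
          rw [h1, deriv_zero]
          exact D.zero_mem
      · rw [e, deriv_add, deriv_add]; ring
      · intro m hm
        obtain ⟨m₀, hm₀, hb⟩ := T.exists_mem_supp_of_mem_supp_deriv_sub c hdμ
          (fun x hx => hfμ x (hF' x hx).1) hm
        have := (hF' m₀ hm₀).2 _ ((T.below j).inv_mem hb)
        rw [inv_div, mul_div_assoc', div_lt_iff_lt_mul, mul_comm m₀] at this
        exact lt_of_mul_lt_mul_right' this
      · intro m hm
        obtain ⟨m₀, hm₀, hb⟩ := T.exists_mem_supp_of_mem_supp_deriv_sub c hdμ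
          (fun x hx => hfμ x (hH' x hx).1) hm
        have := (hH' m₀ hm₀).2 _ ((T.below j).inv_mem hb)
        rw [inv_div, mul_div_assoc', lt_div_iff_mul_lt, mul_comm m₀] at this
        exact lt_of_mul_lt_mul_right' this
    refine T.mem_core.2 ⟨hyA f hf, fun n => ?_, fun n hn => ?_⟩
    · obtain ⟨yF, hF, yG, hG, yH, e, h1, h2⟩ := key n
      obtain ⟨z, hz, ez⟩ := (T.mem_core.1 hG).2.1 n
      refine ⟨yF + z, A.add_mem hF hz, ?_⟩
      have e1 : trunc (yF : Hahn k M) n = yF := trunc_eq_self h1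
      have e2 : trunc (yH : Hahn k M) n = 0 := trunc_eq_zero fun m hm => (h2 m hm).le
      rw [e, Subfield.coe_add, Subfield.coe_add, Subfield.coe_add, ez]
      simp only [trunc, HahnSeries.truncLT_add] at e1 e2 ⊢
      rw [e1, e2, add_zero]
    · obtain ⟨yF, hF, yG, hG, yH, e, h1, h2⟩ := key n
      rw [e, Subfield.coe_add, Subfield.coe_add] at hn
      rcases supp_add_subset _ _ hn with hn | hn
      · rcases supp_add_subset _ _ hn with hn | hn
        · exact absurd (h1 n hn) (lt_irrefl n)
        · exact (T.mem_core.1 hG).2.2 hn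
      · exact absurd (h2 n hn) (lt_irrefl n)

/-- Induction on the level produces the logarithmic derivatives needed by `deriv_mem_core_of_coset`.
Antiderivatives are sought in `V`, not in `A`, because `V` is already known to be truncation closed
and contained in the core. -/
theorem deriv_mem_core {V : AddSubgroup (T.kStar k)} (hconst : ∀ a, T.const a ∈ A)
    (hderiv : ∀ f ∈ A, T.deriv c f ∈ A) (hV : T.TruncationClosed (V : Set (T.kStar k)))
    (hVA : ∀ f ∈ V, f ∈ T.core A (T.unionMonoid (T.admissible c A V))) :
    ∀ f ∈ T.core A (T.unionMonoid (T.admissible c A V)),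
      T.deriv c f ∈ T.core A (T.unionMonoid (T.admissible c A V)) := by
  set P := T.admissible c A V
  have hcoset := fun r hr => T.deriv_mem_core_of_coset c A (P := P) hconst hderiv (r := r) hr
    (j := r) le_rfl
  have hlog : ∀ r, ∀ μ ∈ T.levelMonoid P r, ∃ d ∈ T.core A (T.unionMonoid P),
      T.deriv c (T.monomial μ) = d * T.monomial μ := by
    intro r
    induction r with
    | zero =>
      intro μ hμ
      rw [Submonoid.mem_bot.1 hμ]
      refine ⟨0, zero_mem _, ?_⟩
      have := T.deriv_const c 1
      rwa [map_one, Derivation.map_one_eq_zero, map_zero, ← zero_mul (T.monomial 1),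
        ← T.monomial_one] at this
    | succ r ih =>
      intro μ hμ
      obtain ⟨b, hb, a, ha, rfl⟩ := (T.mem_levelMonoid_succ P).1 hμ
      obtain ⟨d, hd, e⟩ := ih b hb
      refine ⟨d + T.cStar c r a, add_mem hd ?_, ?_⟩
      · rcases ha with rfl | ⟨-, l, hl, h2⟩
        · have h1 := T.eq_const_mul_monomial (f := T.cStar c 0 a) (μ := 1) fun m hm => by
            have := T.supp_cStar_subset c 0 a hm
            rwa [below_zero] at this
          rw [h1, monomial_one, mul_one]
          exact T.const_mem_core _ hconst _
        · obtain ⟨l', hl', h3, h4⟩ :=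
            T.exists_integral_in_below c hV hl h2 (T.supp_cStar_subset c r a)
          rw [← h4]
          refine hcoset r ih l' (hVA l' hl') 1 (one_mem _) fun m hm => ?_
          rw [div_one]
          exact h3 hm
      · rw [monomial_mul, deriv_mul, deriv_monomial, e]; ring
  intro f hf
  obtain ⟨n, hn⟩ := T.exists_supp_subset_below f
  refine hcoset n (hlog n) f hf 1 (one_mem _) fun m hm => ?_
  rw [div_one]
  exact hn hm

/-- The core is additively closed, so it suffices to treat `S`. There, IL-closedness says that every
factor of positive index of a monomial in the support is admissible. -/
theorem subset_core_of_tilClosed {S : Set (T.kStar k)} (hS : T.TILClosed c S) (hSA : S ⊆ A) :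
    ∀ f ∈ AddSubgroup.closure S,
      f ∈ T.core A (T.unionMonoid (T.admissible c A (AddSubgroup.closure S))) := by
  intro f hf
  refine (AddSubgroup.closure_le (K := (T.core A _).toAddSubgroup)).2 ?_ hf
  intro f hf
  refine T.mem_core.2 ⟨hSA hf, fun n => ?_, fun x hx => ?_⟩
  · obtain ⟨g, hg, e⟩ := hS.1 f hf n
    exact ⟨g, hSA hg, e⟩
  · obtain ⟨n, hn⟩ := T.exhaust x
    obtain ⟨m, rfl⟩ := T.exists_prod_eq hn
    refine (T.mem_unionMonoid _).2 ⟨n + 1, (T.prod_mem_levelMonoid_iff _).2 fun i hi => ?_⟩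
    rcases Nat.eq_zero_or_pos i with h | h
    · exact Or.inl h
    · obtain ⟨⟨l, hl, e⟩, h2, -⟩ := hS.2 n m ⟨f, hf, hx⟩ i
        (Finset.mem_Icc.2 ⟨h, Nat.le_of_lt_succ hi⟩)
      exact Or.inr ⟨hSA h2, l, AddSubgroup.subset_closure hl, e⟩

/-- Unique factorization makes each `m_i` admissible. Individual antiderivatives in `V` add up to
one of the sum, and the monomials multiply in `A`. -/
theorem tilClosed_of_subset_core {V : AddSubgroup (T.kStar k)} (hVA : ∀ f ∈ V, f ∈ A)
    (h : ∀ f ∈ A, f ∈ T.core A (T.unionMonoid (T.admissible c A V))) :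
    T.TILClosed c (A : Set (T.kStar k)) := by
  refine ⟨fun f hf n => (T.mem_core.1 (h f hf)).2.1 n, ?_⟩
  rintro n m ⟨f, hf, hm⟩ i hi
  have h1 := (T.prod_mem_levelMonoid_iff _).1 (T.mem_levelMonoid_of_mem_below _
    ((T.mem_core.1 (h f hf)).2.2 hm) (T.prod_mem_below m (n + 1)))
  have h2 : ∀ j ∈ Finset.Icc 1 n, T.monomial (m j : M) ∈ A ∧
      T.HasIntegralIn c V (T.cStar c j (m j)) := by
    intro j hj
    rw [Finset.mem_Icc] at hj
    refine (h1 j (Nat.lt_succ_of_le hj.2)).resolve_left ?_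
    omega
  have hsum : ∀ s : Finset ℕ, (∀ j ∈ s, T.HasIntegralIn c V (T.cStar c j (m j))) →
      T.HasIntegralIn c V (∑ j ∈ s, T.cStar c j (m j)) := by
    intro s hs
    choose! l hl e using hs
    refine ⟨∑ j ∈ s, l j, V.sum_mem hl, ?_⟩
    rw [← sum_congr rfl e]
    exact map_sum (T.differential c).deriv l s
  have hprod : ∀ s : Finset ℕ, (∀ j ∈ s, T.monomial (m j : M) ∈ A) →
      T.monomial (∏ j ∈ s, (m j : M)) ∈ A := by
    intro s hs
    have e : (T.monomial (∏ j ∈ s, (m j : M)) : T.kStar k) = ∏ j ∈ s, T.monomial (m j : M) :=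
      map_prod (⟨⟨T.monomial, T.monomial_one⟩, T.monomial_mul⟩ : M →* T.kStar k) _ s
    rw [e]
    exact A.prod_mem hs
  have hmono : ∀ g, T.HasIntegralIn c V g → T.HasIntegralIn c (A : Set (T.kStar k)) g :=
    fun g ⟨l, hl, e⟩ => ⟨l, hVA l hl, e⟩
  exact ⟨hmono _ (h2 i hi).2, (h2 i hi).1, hmono _ (hsum _ fun j hj => (h2 j hj).2),
    hprod _ fun j hj => (h2 j hj).1⟩

/-- The core of `k{S}` is itself a differential subring containing `k` and `S`, so minimality forces
it to be everything. -/
theorem tilClosed_diffRing {S : Set (T.kStar k)} (hS : T.TILClosed c S) :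
    T.TILClosed c (T.diffRing c S : Set (T.kStar k)) := by
  have hconst : ∀ a, T.const a ∈ T.diffRing c S := fun a =>
    Subring.mem_sInf.2 fun R hR => hR.1 a
  have hSA : S ⊆ T.diffRing c S := fun f hf => Subring.mem_sInf.2 fun R hR => hR.2.1 hf
  have hderiv : ∀ f ∈ T.diffRing c S, T.deriv c f ∈ T.diffRing c S := fun f hf =>
    Subring.mem_sInf.2 fun R hR => hR.2.2 f (Subring.mem_sInf.1 hf R hR)
  have hV := T.subset_core_of_tilClosed c _ hS hSA
  refine T.tilClosed_of_subset_core c _ (fun f hf => (T.mem_core.1 (hV f hf)).1) fun f hf => ?_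
  exact Subring.mem_sInf.1 hf _ ⟨T.const_mem_core _ hconst,
    fun g hg => hV g (AddSubgroup.subset_closure hg),
    T.deriv_mem_core c _ hconst hderiv (T.truncationClosed_closure hS.1) hV⟩

theorem tilClosed_diffField {S : Set (T.kStar k)} (hS : T.TILClosed c S) :
    T.TILClosed c (T.diffField c S : Set (T.kStar k)) := by
  set A := T.diffField c S
  have hconst : ∀ a, T.const a ∈ A.toSubring := fun a =>
    Subfield.mem_sInf.2 fun R hR => hR.1 a
  have hSA : S ⊆ A.toSubring := fun f hf => Subfield.mem_sInf.2 fun R hR => hR.2.1 hf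
  have hderiv : ∀ f ∈ A.toSubring, T.deriv c f ∈ A.toSubring := fun f hf =>
    Subfield.mem_sInf.2 fun R hR => hR.2.2 f (Subfield.mem_sInf.1 hf R hR)
  have hV := T.subset_core_of_tilClosed c _ hS hSA
  refine T.tilClosed_of_subset_core c A.toSubring (fun f hf => (T.mem_core.1 (hV f hf)).1)
    fun f hf => ?_
  -- In a field the admissible monomials are closed under inversion, with antiderivatives negated,
  -- so the core is a subfield and minimality of `k⟨S⟩` applies to it.
  have hinv : ∀ m ∈ T.unionMonoid (T.admissible c A.toSubring (AddSubgroup.closure S)),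
      m⁻¹ ∈ T.unionMonoid (T.admissible c A.toSubring (AddSubgroup.closure S)) := by
    refine fun m hm => T.inv_mem_unionMonoid _ (fun n a ha => ?_) hm
    rcases ha with h | ⟨h1, l, hl, e⟩
    · exact Or.inl h
    · refine Or.inr ⟨?_, -l, neg_mem hl, ?_⟩
      · rw [Subgroup.coe_inv, monomial_inv]
        exact A.inv_mem h1
      · rw [deriv_neg, e, cStar_inv]
  exact Subfield.mem_sInf.1 hf
    { T.core A.toSubring (T.unionMonoid (T.admissible c A.toSubring (AddSubgroup.closure S))) with
      inv_mem' := fun _ hx => T.inv_mem_core A hinv hx }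
    ⟨T.const_mem_core _ hconst, fun g hg => hV g (AddSubgroup.subset_closure hg),
      T.deriv_mem_core c _ hconst hderiv (T.truncationClosed_closure hS.1) hV⟩

end Main

end MonomialChain

end IteratedHahn

end

/-- Let `T` be a chain of monomial groups `M_0, M_1, …` in the ordered abelian group `M`, let `k` be
a differential field, and let `c n : M_n → k_{n-1}` be additive maps inducing the derivation on
`k_*`.  If `S ⊆ k_*` is TIL-closed, then so are `k{S}` and `k⟨S⟩`. -/
theorem mainTheorem5 {k : Type*} [Field k] [Differential k]
    {M : Type*} [CommGroup M] [LinearOrder M] [IsOrderedMonoid M]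
    (T : IteratedHahn.MonomialChain M)
    (c : ∀ n, Additive (T.sub n) →+ IteratedHahn.Hahn k (T.below n))
    (S : Set (T.kStar k)) (hS : T.TILClosed c S) :
    T.TILClosed c (T.diffRing c S : Set (T.kStar k)) ∧
      T.TILClosed c (T.diffField c S : Set (T.kStar k)) :=
  ⟨T.tilClosed_diffRing c hS, T.tilClosed_diffField c hS⟩
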